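/- Two matrices \(A,B\in\mathbb C^{n\times n}\) are *congruent if \(S^*AS=B\) for some nonsingular \(S\). A closure graph for the *congruence classes of \(n\times n\) complex matrices is a directed graph whose vertices \(v\) represent the *congruence classes \(C_v\) in a one-to-one manner and in which there is a directed path (possibly of length \(0\)) from \(v\) to \(w\) if and only if one (equivalently, each) matrix of \(C_v\) can be transformed to a matrix of \(C_w\) by an arbitrarily small perturbation, i.e. lies in the closure of \(C_w\). The codimension over \(\mathbb R\) of the *congruence class of \(A\) is \(2n^2-\dim_{\mathbb R}\{C^*A+AC : C\in\mathbb C^{n\times n}\}\). Let \(\lambda,\mu,\nu,\sigma,\tau\) denote complex numbers with \(|\lambda|=|\mu|=|\nu|=|\tau|=1\), \(\mu\ne\pm\nu\), \(|\sigma|<1\), and let \(\mathbb R_+=[0,\infty)\). **Theorem.** The following graph is a closure graph for the *congruence classes of \(2\times2\) complex matrices. Its vertices are the matrices \[ \begin{bmatrix}\mu&0\\0&\nu\end{bmatrix},\quad \begin{bmatrix}0&1\\\sigma&0\end{bmatrix},\quad \tau\begin{bmatrix}0&1\\1&i\end{bmatrix}\quad(\text{codimension }2), \] \[ \begin{bmatrix}\lambda&0\\0&\lambda\end{bmatrix},\quad\begin{bmatrix}\lambda&0\\0&-\lambda\end{bmatrix}\quad(\text{codimension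 }4),\qquad \begin{bmatrix}\lambda&0\\0&0\end{bmatrix}\quad(\text{codimension }5),\qquad 0\quad(\text{codimension }8), \] where matrices that differ only by a permutation of diagonal entries are the same vertex (\(\mathrm{diag}(\mu,\nu)=\mathrm{diag}(\nu,\mu)\), \(\mathrm{diag}(\lambda,-\lambda)=\mathrm{diag}(-\lambda,\lambda)\)); each vertex represents the *congruence class of its matrix, whose codimension over \(\mathbb R\) is indicated. Each of these matrices is a direct sum of blocks of the form \(\begin{bmatrix}0&I_m\\J_m(c)&0\end{bmatrix}\) (\(0<|c|<1\)), \(c\Delta_m\) (\(|c|=1\)), \(J_m(0)\), with \(m\ge1\), where \(J_m(c)\) is the upper triangular Jordan block and \(\Delta_m\) has \(1\) on the antidiagonal, \(i\) just below it, and \(0\) elsewhere. Each of the six families of nonzero matrices above gives infinitely many vertices. The arrows of the graph are the following, and for every pair of vertices in this list the stated condition is also necessary and sufficient for the first matrix to lie in the closure of the *congruence class of the second: * \(\mathrm{diag}(\lambda,0)\to\mathrm{diag}(\mu,\nu)\) if and only if \(\lambda\in\mu\mathbb R_++\nu\mathbb R_+\); * \(\mathrm{diag}(\lambda,0)\to\tau\begin{bmatrix}0&1\\1&i\end{bmatrix}\)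 if and only if \(\operatorname{Im}(\lambda\bar\tau)\ge0\); * \(\mathrm{diag}(\lambda,-\lambda)\to\tau\begin{bmatrix}0&1\\1&i\end{bmatrix}\) if and only if \(\tau=\pm\lambda\); * for \(|\lambda'|=1\): \(\mathrm{diag}(\lambda,0)\to\mathrm{diag}(\lambda',\lambda')\) if and only if \(\lambda=\lambda'\), and \(\mathrm{diag}(\lambda,0)\to\mathrm{diag}(\lambda',-\lambda')\) if and only if \(\lambda=\pm\lambda'\); * \(\mathrm{diag}(\lambda,0)\to\begin{bmatrix}0&1\\\sigma&0\end{bmatrix}\), \(0\to\mathrm{diag}(\lambda,0)\), \(0\to\mathrm{diag}(\mu,\nu)\), and \(0\to\tau\begin{bmatrix}0&1\\1&i\end{bmatrix}\) for all values of the parameters. There are no other arrows. Moreover, the relation "\(C_v\) is contained in the closure of \(C_w\)" is a partial order on the classes, and its Hasse diagram (the graph of covering pairs) is obtained from this graph by deleting the arrows that are compositions of others: \(0\to\mathrm{diag}(\mu,\nu)\), \(0\to\tau\begin{bmatrix}0&1\\1&i\end{bmatrix}\), and \(\mathrm{diag}(\lambda,0)\to\tau\begin{bmatrix}0&1\\1&i\end{bmatrix}\)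 with \(\lambda=\pm\tau\). -/

import Mathlib

open scoped Matrix

noncomputable section

namespace StarCong

/-- `A` and `B` are *congruent: `Sᴴ A S = B` for a nonsingular `S`. -/
def StarCongruent {n : ℕ} (A B : Matrix (Fin n) (Fin n) ℂ) : Prop :=
  ∃ S : Matrix (Fin n) (Fin n) ℂ, IsUnit S ∧ Sᴴ * A * S = B

theorem StarCongruent.refl {n : ℕ} (A : Matrix (Fin n) (Fin n) ℂ) : StarCongruent A A :=
  ⟨1, isUnit_one, by simp⟩

theorem StarCongruent.symm {n : ℕ} {A B : Matrix (Fin n) (Fin n) ℂ}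
    (h : StarCongruent A B) : StarCongruent B A := by
  obtain ⟨S, hS, rfl⟩ := h
  obtain ⟨u, rfl⟩ := hS
  refine ⟨(↑u⁻¹ : Matrix (Fin n) (Fin n) ℂ), u⁻¹.isUnit, ?_⟩
  have h1 : (u : Matrix (Fin n) (Fin n) ℂ) * (↑u⁻¹ : Matrix (Fin n) (Fin n) ℂ) = 1 :=
    u.mul_inv
  have h2 : (↑u⁻¹ : Matrix (Fin n) (Fin n) ℂ)ᴴ * (u : Matrix (Fin n) (Fin n) ℂ)ᴴ = 1 := by
    rw [← Matrix.conjTranspose_mul, h1, Matrix.conjTranspose_one]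
  calc _ = ((↑u⁻¹ : Matrix (Fin n) (Fin n) ℂ)ᴴ * (u : Matrix (Fin n) (Fin n) ℂ)ᴴ) * A *
        ((u : Matrix (Fin n) (Fin n) ℂ) * (↑u⁻¹ : Matrix (Fin n) (Fin n) ℂ)) := by
        simp only [Matrix.mul_assoc]
    _ = A := by rw [h1, h2, Matrix.one_mul, Matrix.mul_one]

theorem StarCongruent.trans {n : ℕ} {A B C : Matrix (Fin n) (Fin n) ℂ}
    (h : StarCongruent A B) (h' : StarCongruent B C) : StarCongruent A C := by
  obtain ⟨S, hS, rfl⟩ := h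
  obtain ⟨T, hT, rfl⟩ := h'
  exact ⟨S * T, hS.mul hT, by simp only [Matrix.conjTranspose_mul, Matrix.mul_assoc]⟩

/-- *Congruence as an equivalence relation on `n × n` complex matrices. -/
def starSetoid (n : ℕ) : Setoid (Matrix (Fin n) (Fin n) ℂ) where
  r := StarCongruent
  iseqv := ⟨StarCongruent.refl, StarCongruent.symm, StarCongruent.trans⟩

/-- The *congruence class of `A`. -/
def starClass {n : ℕ} (A : Matrix (Fin n) (Fin n) ℂ) : Set (Matrix (Fin n) (Fin n) ℂ) :=
  {B | StarCongruent A B}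

/-- `G`, with the assignment `v ↦ C v`, is a closure graph for the *congruence classes of
`n × n` complex matrices. The vertices represent the classes in a one-to-one manner, and there is
a directed path (possibly of length `0`) from `v` to `w` if and only if one, and equivalently
each, matrix of `C v` can be turned into a matrix of `C w` by an arbitrarily small
perturbation. -/
structure IsClosureGraph (n : ℕ) {V : Type} (G : Digraph V)
    (C : V → Set (Matrix (Fin n) (Fin n) ℂ)) : Prop where
  bijOn : Set.BijOn C Set.univ (starSetoid n).classes
  path_iff_one : ∀ v w : V,
    Relation.ReflTransGen G.Adj v w ↔ ∃ A ∈ C v, A ∈ closure (C w)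
  path_iff_each : ∀ v w : V,
    Relation.ReflTransGen G.Adj v w ↔ ∀ A ∈ C v, A ∈ closure (C w)

/-- `L` covers `K` in the set of *congruence classes ordered by inclusion in the closure. -/
def ClosureCovers {n : ℕ} (K L : Set (Matrix (Fin n) (Fin n) ℂ)) : Prop :=
  K ⊆ closure L ∧ K ≠ L ∧
    ∀ M ∈ (starSetoid n).classes, K ⊆ closure M → M ⊆ closure L → M = K ∨ M = L

/-- The real-linear map `C ↦ Cᴴ A + A C`. -/
def tangentMap {n : ℕ} (A : Matrix (Fin n) (Fin n) ℂ) :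
    Matrix (Fin n) (Fin n) ℂ →ₗ[ℝ] Matrix (Fin n) (Fin n) ℂ where
  toFun C := Cᴴ * A + A * C
  map_add' C D := by
    rw [Matrix.conjTranspose_add, Matrix.add_mul, Matrix.mul_add]; abel
  map_smul' r C := by
    simp [Matrix.conjTranspose_smul]

/-- The real tangent space `{Cᴴ A + A C}` to the *congruence class of `A` at `A`. -/
def tangentSpace {n : ℕ} (A : Matrix (Fin n) (Fin n) ℂ) :
    Submodule ℝ (Matrix (Fin n) (Fin n) ℂ) :=
  LinearMap.range (tangentMap A)

/-- The codimension over `ℝ` of the *congruence class of `A`, in the `2 n ^ 2`-dimensional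
real space of complex `n × n` matrices. -/
def realCodim {n : ℕ} (A : Matrix (Fin n) (Fin n) ℂ) : ℕ :=
  Module.finrank ℝ (Matrix (Fin n) (Fin n) ℂ) - Module.finrank ℝ (tangentSpace A)

/-- The upper triangular Jordan block `J_n(c)`. -/
def jordanBlock (n : ℕ) (c : ℂ) : Matrix (Fin n) (Fin n) ℂ :=
  Matrix.of fun i j => if i = j then c else if (j : ℕ) = (i : ℕ) + 1 then 1 else 0

/-- The matrix `Δ_n`: ones on the antidiagonal, `i` just below it, zeros elsewhere. -/
def deltaBlock (n : ℕ) : Matrix (Fin n) (Fin n) ℂ :=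
  Matrix.of fun i j =>
    if (i : ℕ) + (j : ℕ) + 1 = n then 1
    else if (i : ℕ) + (j : ℕ) = n then Complex.I else 0

/-- The direct sum of two square matrices. -/
def directSum {m n : ℕ} (A : Matrix (Fin m) (Fin m) ℂ) (B : Matrix (Fin n) (Fin n) ℂ) :
    Matrix (Fin (m + n)) (Fin (m + n)) ℂ :=
  Matrix.reindex finSumFinEquiv finSumFinEquiv (Matrix.fromBlocks A 0 0 B)

/-- The canonical blocks for *congruence. -/
inductive IsCanonicalBlock : ∀ {n : ℕ}, Matrix (Fin n) (Fin n) ℂ → Prop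
  | skew (m : ℕ) (c : ℂ) (hm : 0 < m) (h0 : c ≠ 0) (h1 : ‖c‖ < 1) :
      IsCanonicalBlock (Matrix.reindex finSumFinEquiv finSumFinEquiv
        (Matrix.fromBlocks (0 : Matrix (Fin m) (Fin m) ℂ) 1 (jordanBlock m c) 0))
  | delta (n : ℕ) (c : ℂ) (hn : 0 < n) (hc : ‖c‖ = 1) : IsCanonicalBlock (c • deltaBlock n)
  | nilpotent (k : ℕ) (hk : 0 < k) : IsCanonicalBlock (jordanBlock k 0)

/-- Direct sums of canonical blocks. -/
inductive IsCanonical : ∀ {n : ℕ}, Matrix (Fin n) (Fin n) ℂ → Prop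
  | empty : IsCanonical (0 : Matrix (Fin 0) (Fin 0) ℂ)
  | cons {m n : ℕ} (A : Matrix (Fin m) (Fin m) ℂ) (B : Matrix (Fin n) (Fin n) ℂ)
      (hA : IsCanonicalBlock A) (hB : IsCanonical B) : IsCanonical (directSum A B)

/-- The `2 × 2` canonical matrices for *congruence, with their parameters. -/
inductive Canon : Type
  /-- `diag(μ, ν)` with `μ ≠ ±ν` -/
  | generic (μ ν : ℂ) (hμ : ‖μ‖ = 1) (hν : ‖ν‖ = 1) (hne : μ ≠ ν) (hne' : μ ≠ -ν)
  /-- `[[0, 1], [σ, 0]]` -/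
  | anti (σ : ℂ) (hσ : ‖σ‖ < 1)
  /-- `τ [[0, 1], [1, i]]` -/
  | delta (τ : ℂ) (hτ : ‖τ‖ = 1)
  /-- `diag(l, l)` -/
  | same (l : ℂ) (hl : ‖l‖ = 1)
  /-- `diag(l, -l)` -/
  | opp (l : ℂ) (hl : ‖l‖ = 1)
  /-- `diag(l, 0)` -/
  | rankOne (l : ℂ) (hl : ‖l‖ = 1)
  /-- the zero matrix -/
  | zero

namespace Canon

/-- The matrix itself. -/
def mat : Canon → Matrix (Fin 2) (Fin 2) ℂ
  | generic μ ν _ _ _ _ => !![μ, 0; 0, ν]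
  | anti σ _ => !![0, 1; σ, 0]
  | delta τ _ => !![0, τ; τ, τ * Complex.I]
  | same l _ => !![l, 0; 0, l]
  | opp l _ => !![l, 0; 0, -l]
  | rankOne l _ => !![l, 0; 0, 0]
  | zero => 0

/-- The codimension of the horizontal level of the graph on which the matrix is placed. -/
def level : Canon → ℕ
  | generic _ _ _ _ _ _ => 2
  | anti _ _ => 2
  | delta _ _ => 2
  | same _ _ => 4
  | opp _ _ => 4
  | rankOne _ _ => 5
  | zero => 8

/-- Equality up to a permutation of direct summands: `diag(μ, ν)` is identified with
`diag(ν, μ)`, and `diag(l, -l)` with `diag(-l, l)`. -/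
inductive Perm : Canon → Canon → Prop
  | refl (a : Canon) : Perm a a
  | swapGeneric (μ ν : ℂ) (hμ : ‖μ‖ = 1) (hν : ‖ν‖ = 1) (h1 : μ ≠ ν) (h2 : μ ≠ -ν)
      (h3 : ν ≠ μ) (h4 : ν ≠ -μ) :
      Perm (generic μ ν hμ hν h1 h2) (generic ν μ hν hμ h3 h4)
  | swapOpp (l : ℂ) (hl : ‖l‖ = 1) (hl' : ‖-l‖ = 1) : Perm (opp l hl) (opp (-l) hl')

theorem Perm.symm {a b : Canon} (h : Perm a b) : Perm b a := by
  cases h with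
  | refl => exact .refl _
  | swapGeneric μ ν hμ hν h1 h2 h3 h4 => exact .swapGeneric ν μ hν hμ h3 h4 h1 h2
  | swapOpp l hl hl' =>
    have key : ∀ m (hm : ‖m‖ = 1), m = l → Perm (opp (-l) hl') (opp m hm) →
        Perm (opp (-l) hl') (opp l hl) := by
      rintro m hm rfl h; exact h
    exact key (- -l) (by simpa using hl) (neg_neg l) (.swapOpp (-l) hl' _)

theorem Perm.trans {a b c : Canon} (h : Perm a b) (h' : Perm b c) : Perm a c := by
  cases h with
  | refl => exact h'
  | swapGeneric μ ν hμ hν h1 h2 h3 h4 =>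
    cases h' with
    | refl => exact .swapGeneric μ ν hμ hν h1 h2 h3 h4
    | swapGeneric => exact .refl _
  | swapOpp l hl hl' =>
    cases h' with
    | refl => exact .swapOpp l hl hl'
    | swapOpp _ _ h =>
      have key : ∀ m (hm : ‖m‖ = 1), m = l → Perm (opp l hl) (opp m hm) := by
        rintro m hm rfl; exact .refl _
      exact key _ h (neg_neg l)

/-- Equality up to a permutation of direct summands. -/
def permSetoid : Setoid Canon where
  r := Perm
  iseqv := ⟨Perm.refl, Perm.symm, Perm.trans⟩

/-- The arrows drawn in the closure graph. -/
inductive Arrow : Canon → Canon → Prop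
  | zero_rankOne (l : ℂ) (hl : ‖l‖ = 1) : Arrow zero (rankOne l hl)
  | zero_generic (μ ν : ℂ) (hμ : ‖μ‖ = 1) (hν : ‖ν‖ = 1) (h1 : μ ≠ ν) (h2 : μ ≠ -ν) :
      Arrow zero (generic μ ν hμ hν h1 h2)
  | zero_delta (τ : ℂ) (hτ : ‖τ‖ = 1) : Arrow zero (delta τ hτ)
  | rankOne_same (l : ℂ) (hl : ‖l‖ = 1) : Arrow (rankOne l hl) (same l hl)
  | rankOne_opp (l : ℂ) (hl : ‖l‖ = 1) : Arrow (rankOne l hl) (opp l hl)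
  | rankOne_generic (l μ ν : ℂ) (hl : ‖l‖ = 1) (hμ : ‖μ‖ = 1) (hν : ‖ν‖ = 1)
      (h1 : μ ≠ ν) (h2 : μ ≠ -ν) (h : ∃ a b : ℝ, 0 ≤ a ∧ 0 ≤ b ∧ l = μ * a + ν * b) :
      Arrow (rankOne l hl) (generic μ ν hμ hν h1 h2)
  | rankOne_anti (l σ : ℂ) (hl : ‖l‖ = 1) (hσ : ‖σ‖ < 1) :
      Arrow (rankOne l hl) (anti σ hσ)
  | rankOne_delta (l τ : ℂ) (hl : ‖l‖ = 1) (hτ : ‖τ‖ = 1)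
      (h : 0 ≤ (l * (starRingEnd ℂ) τ).im) : Arrow (rankOne l hl) (delta τ hτ)
  | opp_delta (l τ : ℂ) (hl : ‖l‖ = 1) (hτ : ‖τ‖ = 1) (h : τ = l ∨ τ = -l) :
      Arrow (opp l hl) (delta τ hτ)

/-- The arrows that join consecutive elements of the closure order: those that are left when
`0 → diag(μ, ν)`, `0 → τ [[0, 1], [1, i]]`, and `diag(l, 0) → τ [[0, 1], [1, i]]` with `l = ±τ`
are deleted. -/
inductive HasseArrow : Canon → Canon → Prop
  | zero_rankOne (l : ℂ) (hl : ‖l‖ = 1) : HasseArrow zero (rankOne l hl)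
  | rankOne_same (l : ℂ) (hl : ‖l‖ = 1) : HasseArrow (rankOne l hl) (same l hl)
  | rankOne_opp (l : ℂ) (hl : ‖l‖ = 1) : HasseArrow (rankOne l hl) (opp l hl)
  | rankOne_generic (l μ ν : ℂ) (hl : ‖l‖ = 1) (hμ : ‖μ‖ = 1) (hν : ‖ν‖ = 1)
      (h1 : μ ≠ ν) (h2 : μ ≠ -ν) (h : ∃ a b : ℝ, 0 ≤ a ∧ 0 ≤ b ∧ l = μ * a + ν * b) :
      HasseArrow (rankOne l hl) (generic μ ν hμ hν h1 h2)
  | rankOne_anti (l σ : ℂ) (hl : ‖l‖ = 1) (hσ : ‖σ‖ < 1) :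
      HasseArrow (rankOne l hl) (anti σ hσ)
  | rankOne_delta (l τ : ℂ) (hl : ‖l‖ = 1) (hτ : ‖τ‖ = 1)
      (h : 0 < (l * (starRingEnd ℂ) τ).im) : HasseArrow (rankOne l hl) (delta τ hτ)
  | opp_delta (l τ : ℂ) (hl : ‖l‖ = 1) (hτ : ‖τ‖ = 1) (h : τ = l ∨ τ = -l) :
      HasseArrow (opp l hl) (delta τ hτ)

end Canon

/-- The vertices: canonical matrices up to a permutation of direct summands. -/
def Vertex : Type := Quotient Canon.permSetoid

/-- The vertex given by a canonical matrix. -/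
def Canon.vertex (a : Canon) : Vertex := Quotient.mk Canon.permSetoid a

/-- The matrices represented by a vertex: those *congruent to its canonical matrix. -/
def vertexClass (v : Vertex) : Set (Matrix (Fin 2) (Fin 2) ℂ) :=
  {A | ∃ a : Canon, a.vertex = v ∧ StarCongruent a.mat A}

/-- The directed graph with the arrows listed above. -/
def graphTwo : Digraph Vertex where
  Adj v w := ∃ a b : Canon, a.vertex = v ∧ b.vertex = w ∧ Canon.Arrow a b

/-- The arrow `a → b` is present in the graph if and only if `p` holds, and `p` is also exactly
the condition under which an arbitrarily small perturbation of the canonical matrix `a` can be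
*congruent to the canonical matrix `b`. -/
def ArrowIff (a b : Canon) (p : Prop) : Prop :=
  (graphTwo.Adj a.vertex b.vertex ↔ p) ∧ (a.mat ∈ closure (starClass b.mat) ↔ p)

end StarCong

end

namespace StarCong

open ComplexConjugate

/-! Two kinds of data obstruct degenerations. First, `det A` and the real number `cross A` are both
multiplied by `|det S|²` under *congruence, so if `A` is a limit of matrices *congruent to `B`, the
pair for `A` is a nonnegative multiple of the pair for `B` (`exists_ray_of_mem_closure`). Among
canonical matrices with nonzero determinant the quotient of `cross` by `|det|` is `2` for `diag(l,
l)`, strictly between `-2` and `2` for the generic ones, `-2` for `diag(l, -l)` and the delta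
family, and below `-2` for `[[0, 1], [σ, 0]]`; so almost all pairs are excluded. Second, the values
`v* A v` lie in every closed set that contains all values `v* B v` (`form_mem_of_mem_closure`). This
yields the conditions on `diag(l, 0)` and settles the signs that `det` and `cross` leave open.

Conversely, `diag(l, 0)` with `l ≠ 0` is a limit of matrices *congruent to `B` whenever `l` is a
value of the form of `B`: shrink the second basis vector (`rankOne_mem_closure`). The only other
nontrivial degeneration, of the delta family to `diag(l, -l)`, comes from rescaling a basis
(`opp_mem_closure_delta`).

Every matrix reduces to a canonical one (`exists_canon`): an isotropic vector puts a zero in the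
corner, and without one an eigenvector of `(A*)⁻¹ A` splits the form. Codimension drops strictly
along arrows, so paths are antisymmetric. Uniqueness of the canonical forms follows from this rather
than being proved in advance. -/

/-! ### Closures of *congruence classes -/

theorem mem_closure_starClass_of_starCongruent {n : ℕ} {A A' B : Matrix (Fin n) (Fin n) ℂ}
    (h : StarCongruent A A') (hA : A ∈ closure (starClass B)) : A' ∈ closure (starClass B) := by
  obtain ⟨S, hS, rfl⟩ := h
  have hc : Continuous fun X : Matrix (Fin n) (Fin n) ℂ => Sᴴ * X * S := by fun_prop
  exact map_mem_closure (f := fun X => Sᴴ * X * S) hc hA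
    fun X hX => StarCongruent.trans hX ⟨S, hS, rfl⟩

theorem starClass_subset_closure {n : ℕ} {A B : Matrix (Fin n) (Fin n) ℂ}
    (h : A ∈ closure (starClass B)) : starClass A ⊆ closure (starClass B) :=
  fun _ hX => mem_closure_starClass_of_starCongruent hX h

theorem mem_starClass_self {n : ℕ} (A : Matrix (Fin n) (Fin n) ℂ) : A ∈ starClass A :=
  StarCongruent.refl A

theorem mem_closure_starClass_trans {n : ℕ} {A B C : Matrix (Fin n) (Fin n) ℂ}
    (h : A ∈ closure (starClass B)) (h' : B ∈ closure (starClass C)) :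
    A ∈ closure (starClass C) :=
  closure_minimal (starClass_subset_closure h') isClosed_closure h

theorem starClass_eq {n : ℕ} {A B : Matrix (Fin n) (Fin n) ℂ} (h : StarCongruent A B) :
    starClass A = starClass B :=
  Set.ext fun _ => ⟨fun hX => h.symm.trans hX, fun hX => h.trans hX⟩

/-! ### The invariant ray of `det` and `cross` -/

/-- The middle coefficient of the pencil `det (A - z Aᴴ)`, up to sign. -/
def cross (A : Matrix (Fin 2) (Fin 2) ℂ) : ℂ :=
  A 0 0 * conj (A 1 1) + conj (A 0 0) * A 1 1 - A 0 1 * conj (A 0 1) - A 1 0 * conj (A 1 0)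

theorem cross_conj (A S : Matrix (Fin 2) (Fin 2) ℂ) :
    cross (Sᴴ * A * S) = (Complex.normSq S.det : ℂ) * cross A := by
  rw [← Complex.mul_conj]
  simp only [cross, Matrix.mul_apply, Fin.sum_univ_two, Matrix.conjTranspose_apply,
    Matrix.det_fin_two, map_add, map_sub, map_mul, Complex.star_def, Complex.conj_conj]
  ring

theorem det_conj (A S : Matrix (Fin 2) (Fin 2) ℂ) :
    (Sᴴ * A * S).det = (Complex.normSq S.det : ℂ) * A.det := by
  rw [← Complex.mul_conj, Matrix.det_mul, Matrix.det_mul, Matrix.det_conjTranspose,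
    Complex.star_def]
  ring

theorem isClosed_ray {E : Type*} [NormedAddCommGroup E] [NormedSpace ℝ E] (v : E) :
    IsClosed ((fun r : ℝ => r • v) '' Set.Ici 0) := by
  by_cases hv : v = 0
  · subst hv
    simp only [smul_zero]
    rw [Set.Nonempty.image_const ⟨0, Set.self_mem_Ici⟩]
    exact isClosed_singleton
  · exact (isClosedEmbedding_smul_left hv).isClosedMap _ isClosed_Ici

/-- Both quantities scale by the same factor `|det S|² ≥ 0`, so the pair stays on one ray, and a ray
including its origin is closed. -/
theorem exists_ray_of_mem_closure {A B : Matrix (Fin 2) (Fin 2) ℂ}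
    (h : A ∈ closure (starClass B)) :
    ∃ r : ℝ, 0 ≤ r ∧ A.det = r * B.det ∧ cross A = r * cross B := by
  have hc : Continuous fun X : Matrix (Fin 2) (Fin 2) ℂ => (X.det, cross X) := by
    unfold cross
    fun_prop
  have hmem := map_mem_closure (t := (fun r : ℝ => r • (B.det, cross B)) '' Set.Ici 0) hc h
    (by
      rintro X ⟨S, -, rfl⟩
      refine ⟨Complex.normSq S.det, Complex.normSq_nonneg _, ?_⟩
      simp only [det_conj, cross_conj, Prod.smul_mk, Complex.real_smul])
  rw [(isClosed_ray _).closure_eq] at hmem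
  obtain ⟨r, hr, h⟩ := hmem
  simp only [Prod.smul_mk, Prod.mk.injEq, Complex.real_smul] at h
  exact ⟨r, hr, h.1.symm, h.2.symm⟩

/-! ### The numerical cone -/

/-- The sesquilinear form of `A` on the diagonal. -/
def form (A : Matrix (Fin 2) (Fin 2) ℂ) (x y : ℂ) : ℂ :=
  conj x * (A 0 0 * x + A 0 1 * y) + conj y * (A 1 0 * x + A 1 1 * y)

theorem form_conj (A S : Matrix (Fin 2) (Fin 2) ℂ) (x y : ℂ) :
    form (Sᴴ * A * S) x y = form A (S 0 0 * x + S 0 1 * y) (S 1 0 * x + S 1 1 * y) := by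
  simp only [form, Matrix.mul_apply, Fin.sum_univ_two, Matrix.conjTranspose_apply, map_add,
    map_mul, Complex.star_def]
  ring

/-- A closed set that contains the numerical cone of `B` contains that of every matrix in the closure
of the class of `B`. -/
theorem form_mem_of_mem_closure {A B : Matrix (Fin 2) (Fin 2) ℂ} {K : Set ℂ}
    (hK : IsClosed K) (hB : ∀ x y, form B x y ∈ K) (h : A ∈ closure (starClass B)) (x y : ℂ) :
    form A x y ∈ K := by
  have hc : Continuous fun X : Matrix (Fin 2) (Fin 2) ℂ => form X x y := by
    unfold form
    fun_prop
  have hmem := map_mem_closure (t := K) hc h (by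
    rintro X ⟨S, -, rfl⟩
    simp only [form_conj]
    exact hB _ _)
  rwa [hK.closure_eq] at hmem

/-! ### Degenerations along a curve -/

theorem isUnit_of_det_ne_zero {S : Matrix (Fin 2) (Fin 2) ℂ} (h : S.det ≠ 0) : IsUnit S :=
  (Matrix.isUnit_iff_isUnit_det S).2 (isUnit_iff_ne_zero.2 h)

theorem starCongruent_of_det_ne_zero {A B : Matrix (Fin 2) (Fin 2) ℂ} (p q r s : ℂ)
    (hS : p * s - q * r ≠ 0) (h : !![p, q; r, s]ᴴ * A * !![p, q; r, s] = B) :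
    StarCongruent A B :=
  ⟨!![p, q; r, s], isUnit_of_det_ne_zero (by simpa [Matrix.det_fin_two] using hS), h⟩

theorem mem_closure_of_continuous {A B : Matrix (Fin 2) (Fin 2) ℂ}
    (f : ℝ → Matrix (Fin 2) (Fin 2) ℂ)
    (hf : Continuous f) (h0 : f 0 = A) (h : ∀ t, 0 < t → StarCongruent B (f t)) :
    A ∈ closure (starClass B) := by
  have h1 : Set.MapsTo f (Set.Ioi 0) (starClass B) := fun t ht => h t ht
  have h2 : (0 : ℝ) ∈ closure (Set.Ioi (0 : ℝ)) := by simp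
  exact h0 ▸ map_mem_closure hf h2 h1

/-- In the basis `(x, y)`, `t (u, v)` the corner entry is `l`, and all other entries tend to zero
with `t`. -/
theorem rankOne_mem_closure {B : Matrix (Fin 2) (Fin 2) ℂ} {l : ℂ} (hl : l ≠ 0) (x y : ℂ)
    (h : form B x y = l) : !![l, 0; 0, 0] ∈ closure (starClass B) := by
  obtain ⟨u, v, huv⟩ : ∃ u v : ℂ, x * v - u * y ≠ 0 := by
    by_cases hx : x = 0
    · refine ⟨1, 0, ?_⟩
      rintro hy
      apply hl
      have hy : y = 0 := by simpa using hy
      rw [← h, hx, hy]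
      simp [form]
    · exact ⟨0, 1, by simpa using hx⟩
  refine mem_closure_of_continuous
    (fun t : ℝ => !![x, t * u; y, t * v]ᴴ * B * !![x, t * u; y, t * v]) ?_ ?_ ?_
  · have : Continuous fun t : ℝ => !![x, t * u; y, t * v] := by
      refine continuous_matrix fun i j => ?_
      fin_cases i <;> fin_cases j <;> simp <;> fun_prop
    fun_prop
  · ext i j
    fin_cases i <;> fin_cases j <;>
      simp [Matrix.mul_apply, Fin.sum_univ_two, ← h, form]
    ring
  · intro t ht
    refine starCongruent_of_det_ne_zero _ _ _ _ ?_ rfl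
    have : x * (t * v) - t * u * y = t * (x * v - u * y) := by ring
    rw [this]
    exact mul_ne_zero (by exact_mod_cast ht.ne') huv

theorem zero_mem_closure (B : Matrix (Fin 2) (Fin 2) ℂ) : 0 ∈ closure (starClass B) := by
  refine mem_closure_of_continuous
    (fun t : ℝ => !![(t : ℂ), 0; 0, t]ᴴ * B * !![(t : ℂ), 0; 0, t]) ?_ ?_ ?_
  · have : Continuous fun t : ℝ => !![(t : ℂ), 0; 0, t] := by
      refine continuous_matrix fun i j => ?_
      fin_cases i <;> fin_cases j <;> simp <;> fun_prop
    fun_prop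
  · ext i j
    fin_cases i <;> fin_cases j <;> simp [Matrix.mul_apply, Fin.sum_univ_two]
  · intro t ht
    refine starCongruent_of_det_ne_zero _ _ _ _ ?_ rfl
    simpa using ht.ne'

/-! ### Values of the canonical forms -/

theorem conj_mul_self {l : ℂ} (hl : ‖l‖ = 1) : conj l * l = 1 := by
  rw [mul_comm, Complex.mul_conj, Complex.normSq_eq_norm_sq, hl]; simp

theorem ne_zero_of_norm_one {l : ℂ} (hl : ‖l‖ = 1) : l ≠ 0 := by
  rintro rfl; simp at hl

theorem eq_or_eq_neg_of_im_eq_zero {l τ : ℂ} (hl : ‖l‖ = 1) (hτ : ‖τ‖ = 1)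
    (h : (l * conj τ).im = 0) : l = τ ∨ l = -τ := by
  have h1 : l * conj τ = ((l * conj τ).re : ℂ) := Complex.ext (by simp) (by simpa using h)
  have h2 : l = (l * conj τ).re * τ := by
    rw [← h1, mul_assoc, conj_mul_self hτ, mul_one]
  have h3 : |(l * conj τ).re| = 1 := by
    have := congrArg norm h2
    rw [norm_mul, hl, hτ, mul_one, Complex.norm_real] at this
    exact this.symm
  rcases abs_eq_abs.1 (h3.trans abs_one.symm) with h4 | h4 <;> rw [h4] at h2
  · left; simpa using h2
  · right; simpa using h2

theorem form_generic (μ ν x y : ℂ) :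
    form !![μ, 0; 0, ν] x y = μ * (‖x‖ ^ 2 : ℝ) + ν * (‖y‖ ^ 2 : ℝ) := by
  rw [← Complex.normSq_eq_norm_sq, ← Complex.normSq_eq_norm_sq, ← Complex.mul_conj,
    ← Complex.mul_conj]
  simp [form]
  ring

theorem form_delta (τ x y : ℂ) :
    form !![0, τ; τ, τ * Complex.I] x y =
      τ * ((2 * (conj x * y).re : ℝ) + (‖y‖ ^ 2 : ℝ) * Complex.I) := by
  rw [← Complex.normSq_eq_norm_sq, ← Complex.mul_conj, ← Complex.add_conj]
  simp [form]
  ring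

theorem mul_conj_im_swap (μ ν : ℂ) : (ν * conj μ).im = -(μ * conj ν).im := by
  simp; ring

theorem mul_conj_im_self (μ : ℂ) : (μ * conj μ).im = 0 := by
  simp; ring

theorem mul_conj_self {l : ℂ} (hl : ‖l‖ = 1) : l * conj l = 1 := by
  rw [mul_comm, conj_mul_self hl]

theorem mul_conj_im_ne_zero {μ ν : ℂ} (hμ : ‖μ‖ = 1) (hν : ‖ν‖ = 1) (h : μ ≠ ν) (h' : μ ≠ -ν) :
    (μ * conj ν).im ≠ 0 :=
  fun h0 => (eq_or_eq_neg_of_im_eq_zero hμ hν h0).elim h h'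

/-- The two inequalities cut out the cone spanned by `μ` and `ν`. The factor `Im (μ ν̄)` makes them
independent of the orientation of this pair. -/
theorem form_im_generic {μ ν : ℂ} {A : Matrix (Fin 2) (Fin 2) ℂ}
    (h : A ∈ closure (starClass !![μ, 0; 0, ν])) (x y : ℂ) :
    0 ≤ (form A x y * conj ν).im * (μ * conj ν).im ∧
      (form A x y * conj μ).im * (μ * conj ν).im ≤ 0 := by
  refine form_mem_of_mem_closure
    (K := {z | 0 ≤ (z * conj ν).im * (μ * conj ν).im ∧ (z * conj μ).im * (μ * conj ν).im ≤ 0})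
    ?_ ?_ h x y
  · have h1 : IsClosed {z : ℂ | 0 ≤ (z * conj ν).im * (μ * conj ν).im} :=
      isClosed_le (by fun_prop) (by fun_prop)
    have h2 : IsClosed {z : ℂ | (z * conj μ).im * (μ * conj ν).im ≤ 0} :=
      isClosed_le (by fun_prop) (by fun_prop)
    exact h1.inter h2
  · intro x y
    rw [form_generic]
    generalize ha : ‖x‖ ^ 2 = a
    generalize hb : ‖y‖ ^ 2 = b
    have ha0 : 0 ≤ a := ha ▸ sq_nonneg _
    have hb0 : 0 ≤ b := hb ▸ sq_nonneg _
    have e1 : ((μ * (a : ℂ) + ν * (b : ℂ)) * conj ν).im = a * (μ * conj ν).im := by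
      simp; ring
    have e2 : ((μ * (a : ℂ) + ν * (b : ℂ)) * conj μ).im = -(b * (μ * conj ν).im) := by
      simp; ring
    simp only [Set.mem_ofPred_eq, e1, e2]
    constructor
    · nlinarith [mul_nonneg ha0 (mul_self_nonneg (μ * conj ν).im)]
    · nlinarith [mul_nonneg hb0 (mul_self_nonneg (μ * conj ν).im)]

theorem form_im_delta {τ : ℂ} (hτ : ‖τ‖ = 1) {A : Matrix (Fin 2) (Fin 2) ℂ}
    (h : A ∈ closure (starClass !![0, τ; τ, τ * Complex.I])) (x y : ℂ) :
    0 ≤ (form A x y * conj τ).im := by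
  refine form_mem_of_mem_closure (K := {z | 0 ≤ (z * conj τ).im})
    (isClosed_le (by fun_prop) (by fun_prop)) ?_ h x y
  intro x y
  rw [form_delta]
  simp only [Set.mem_ofPred_eq]
  rw [mul_comm, ← mul_assoc, conj_mul_self hτ, one_mul]
  simp only [Complex.add_im, Complex.ofReal_im, Complex.im_ofReal_mul,
    Complex.I_im, mul_one, zero_add]
  positivity

/-- When `l ≠ 0`, `hc` says that `c` is a real multiple of `l`, so the form takes its values on one
real line. -/
theorem form_real_of_diag {l c : ℂ} (hc : (c * conj l).im = 0) {A : Matrix (Fin 2) (Fin 2) ℂ}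
    (h : A ∈ closure (starClass !![l, 0; 0, c])) (x y : ℂ) :
    (form A x y * conj l).im = 0 := by
  refine form_mem_of_mem_closure (K := {z | (z * conj l).im = 0})
    (isClosed_eq (by fun_prop) (by fun_prop)) ?_ h x y
  intro x y
  rw [form_generic]
  simp only [Set.mem_ofPred_eq]
  have e : ((l * (‖x‖ ^ 2 : ℝ) + c * (‖y‖ ^ 2 : ℝ)) * conj l).im =
      ‖x‖ ^ 2 * (l * conj l).im + ‖y‖ ^ 2 * (c * conj l).im := by
    simp only [add_mul, Complex.add_im, Complex.mul_im, Complex.mul_re, Complex.conj_re,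
      Complex.conj_im, Complex.ofReal_re, Complex.ofReal_im]
    ring
  rw [e, hc, mul_conj_im_self]
  simp

theorem form_nonneg_of_diag {l c : ℂ} (hc : 0 ≤ (c * conj l).re) {A : Matrix (Fin 2) (Fin 2) ℂ}
    (h : A ∈ closure (starClass !![l, 0; 0, c])) (x y : ℂ) :
    0 ≤ (form A x y * conj l).re := by
  refine form_mem_of_mem_closure (K := {z | 0 ≤ (z * conj l).re})
    (isClosed_le (by fun_prop) (by fun_prop)) ?_ h x y
  intro x y
  rw [form_generic]
  simp only [Set.mem_ofPred_eq]
  have e : ((l * (‖x‖ ^ 2 : ℝ) + c * (‖y‖ ^ 2 : ℝ)) * conj l).re =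
      ‖x‖ ^ 2 * Complex.normSq l + ‖y‖ ^ 2 * (c * conj l).re := by
    simp only [add_mul, Complex.add_re, Complex.mul_im, Complex.mul_re, Complex.conj_re,
      Complex.conj_im, Complex.ofReal_re, Complex.ofReal_im, Complex.normSq_apply]
    ring
  rw [e]
  have := Complex.normSq_nonneg l
  positivity

/-- A unit number in the upper left corner of a matrix in the closure of the class of `diag(m, c)`,
where `c` is a nonnegative multiple of `m`, equals `m`. -/
theorem eq_of_form_diag {l m c : ℂ} (hl : ‖l‖ = 1) (hm : ‖m‖ = 1) (hc : (c * conj m).im = 0)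
    (hc' : 0 ≤ (c * conj m).re) {A : Matrix (Fin 2) (Fin 2) ℂ} (hA : A 0 0 = l)
    (h : A ∈ closure (starClass !![m, 0; 0, c])) : l = m := by
  have hf : form A 1 0 = l := by simp [form, hA]
  have h1 := form_real_of_diag hc h 1 0
  have h2 := form_nonneg_of_diag hc' h 1 0
  rw [hf] at h1 h2
  rcases eq_or_eq_neg_of_im_eq_zero hl hm h1 with h3 | h3
  · exact h3
  · rw [h3, neg_mul, mul_conj_self hm] at h2
    norm_num at h2

/-- Cramer's rule for `l` in the real basis `μ`, `ν` of the plane; the inequalities are the signs of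
the coordinates. -/
theorem mem_cone_of_im {l μ ν : ℂ} (h0 : (μ * conj ν).im ≠ 0)
    (h1 : 0 ≤ (l * conj ν).im * (μ * conj ν).im) (h2 : (l * conj μ).im * (μ * conj ν).im ≤ 0) :
    ∃ a b : ℝ, 0 ≤ a ∧ 0 ≤ b ∧ l = μ * a + ν * b := by
  refine ⟨(l * conj ν).im / (μ * conj ν).im, -(l * conj μ).im / (μ * conj ν).im, ?_, ?_, ?_⟩
  · rw [← mul_div_mul_right _ _ h0]
    exact div_nonneg h1 (mul_self_nonneg _)
  · rw [← mul_div_mul_right _ _ h0]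
    exact div_nonneg (by linarith) (mul_self_nonneg _)
  · have e : l * (μ * conj ν).im = μ * (l * conj ν).im - ν * (l * conj μ).im := by
      apply Complex.ext <;> simp <;> ring
    have h0' : ((μ * conj ν).im : ℂ) ≠ 0 := by exact_mod_cast h0
    apply mul_right_cancel₀ h0'
    rw [e]
    push_cast
    field_simp
    ring

/-! ### Attained values and the degenerations they give -/

theorem exists_form_generic {l μ ν : ℂ} (h : ∃ a b : ℝ, 0 ≤ a ∧ 0 ≤ b ∧ l = μ * a + ν * b) :
    ∃ x y, form !![μ, 0; 0, ν] x y = l := by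
  obtain ⟨a, b, ha, hb, rfl⟩ := h
  refine ⟨(Real.sqrt a : ℂ), (Real.sqrt b : ℂ), ?_⟩
  rw [form_generic]
  simp [Real.sq_sqrt ha, Real.sq_sqrt hb]

theorem exists_form_anti {σ : ℂ} (hσ : ‖σ‖ < 1) (l : ℂ) :
    ∃ x y, form !![0, 1; σ, 0] x y = l := by
  -- With `x = 1` the equation is `y + σ ȳ = l`; eliminating `ȳ` by means of the conjugate equation
  -- gives this `y`.
  refine ⟨1, (l - σ * conj l) / (1 - Complex.normSq σ : ℝ), ?_⟩
  have h1 : (1 - Complex.normSq σ : ℝ) ≠ 0 := by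
    rw [Complex.normSq_eq_norm_sq]
    nlinarith [norm_nonneg σ]
  have h2 : ((1 - Complex.normSq σ : ℝ) : ℂ) ≠ 0 := by exact_mod_cast h1
  simp only [form, Matrix.of_apply, Matrix.cons_val', Matrix.cons_val_zero, Matrix.cons_val_one,
    Matrix.cons_val_fin_one, map_one, map_div₀, map_sub, map_mul, Complex.conj_conj,
    Complex.conj_ofReal]
  field_simp
  push_cast
  rw [← Complex.mul_conj]
  ring

theorem exists_form_delta {l τ : ℂ} (hτ : ‖τ‖ = 1) (h : 0 < (l * conj τ).im) :
    ∃ x y, form !![0, τ; τ, τ * Complex.I] x y = l := by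
  have hs := Real.sqrt_pos.2 h
  -- For real `x`, `y` the form is `τ (2xy + y² i)`: `y` is fixed by the imaginary part of `l τ̄`,
  -- then `x` by its real part.
  refine ⟨((l * conj τ).re / (2 * Real.sqrt (l * conj τ).im) : ℝ),
    (Real.sqrt (l * conj τ).im : ℝ), ?_⟩
  rw [form_delta, Complex.conj_ofReal, ← Complex.ofReal_mul, Complex.ofReal_re,
    Complex.norm_real, Real.norm_eq_abs, sq_abs, Real.sq_sqrt h.le]
  have e : 2 * ((l * conj τ).re / (2 * Real.sqrt (l * conj τ).im) * Real.sqrt (l * conj τ).im) =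
      (l * conj τ).re := by
    field_simp
  rw [e, Complex.re_add_im, mul_comm, mul_assoc, conj_mul_self hτ, mul_one]

theorem starCongruent_antidiag_opp (τ : ℂ) : StarCongruent !![0, τ; τ, 0] !![τ, 0; 0, -τ] := by
  have h2 : conj (2 : ℂ) = 2 := map_ofNat _ 2
  refine starCongruent_of_det_ne_zero 1 1 (1 / 2) (-1 / 2) (by norm_num) ?_
  ext i j
  fin_cases i <;> fin_cases j <;>
    simp [Matrix.mul_apply, Fin.sum_univ_two, h2] <;> ring

theorem starCongruent_diag_swap (μ ν : ℂ) : StarCongruent !![μ, 0; 0, ν] !![ν, 0; 0, μ] := by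
  refine starCongruent_of_det_ne_zero 0 1 1 0 (by norm_num) ?_
  ext i j
  fin_cases i <;> fin_cases j <;> simp [Matrix.mul_apply, Fin.sum_univ_two]

/-- Rescaling by `diag(1/t, t)` keeps the off-diagonal entries and multiplies the corner `τ i` by
`t²`. The limit `[[0, τ], [τ, 0]]` is a hyperbolic plane, *congruent to `diag(τ, -τ)`. -/
theorem opp_mem_closure_delta (τ : ℂ) :
    !![τ, 0; 0, -τ] ∈ closure (starClass !![0, τ; τ, τ * Complex.I]) := by
  refine mem_closure_starClass_of_starCongruent (starCongruent_antidiag_opp τ) ?_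
  refine mem_closure_of_continuous (fun t : ℝ => !![0, τ; τ, τ * Complex.I * t ^ 2]) ?_ ?_ ?_
  · refine continuous_matrix fun i j => ?_
    fin_cases i <;> fin_cases j <;> simp <;> fun_prop
  · simp
  · intro t ht
    have ht' : (t : ℂ) ≠ 0 := by exact_mod_cast ht.ne'
    refine starCongruent_of_det_ne_zero (t : ℂ)⁻¹ 0 0 t (by simp [ht']) ?_
    ext i j
    fin_cases i <;> fin_cases j <;> simp [Matrix.mul_apply, Fin.sum_univ_two]
    · field_simp
    · field_simp
    · ring

theorem opp_mem_closure_delta_of_eq {l τ : ℂ} (h : τ = l ∨ τ = -l) :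
    !![l, 0; 0, -l] ∈ closure (starClass !![0, τ; τ, τ * Complex.I]) := by
  rcases h with rfl | rfl
  · exact opp_mem_closure_delta τ
  · have := opp_mem_closure_delta (-l)
    rw [neg_neg] at this
    exact mem_closure_starClass_of_starCongruent (starCongruent_diag_swap _ _) this

theorem rankOne_mem_closure_opp {l m : ℂ} (hl : ‖l‖ = 1) (h : l = m ∨ l = -m) :
    !![l, 0; 0, 0] ∈ closure (starClass !![m, 0; 0, -m]) := by
  rcases h with rfl | rfl
  · exact rankOne_mem_closure (ne_zero_of_norm_one hl) 1 0 (by simp [form])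
  · exact rankOne_mem_closure (ne_zero_of_norm_one hl) 0 1 (by simp [form])

theorem rankOne_mem_closure_delta {l τ : ℂ} (hl : ‖l‖ = 1) (hτ : ‖τ‖ = 1)
    (h : 0 ≤ (l * conj τ).im) :
    !![l, 0; 0, 0] ∈ closure (starClass !![0, τ; τ, τ * Complex.I]) := by
  rcases h.lt_or_eq with h | h
  · obtain ⟨x, y, hxy⟩ := exists_form_delta hτ h
    exact rankOne_mem_closure (ne_zero_of_norm_one hl) x y hxy
  -- On the boundary `l = ±τ` is not a value of the form, so the degeneration passes through
  -- `diag(τ, -τ)`.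
  · exact mem_closure_starClass_trans
      (rankOne_mem_closure_opp hl (eq_or_eq_neg_of_im_eq_zero hl hτ h.symm))
      (opp_mem_closure_delta τ)

/-! ### Reduction to canonical form -/

theorem exists_canon_of_starCongruent {A B : Matrix (Fin 2) (Fin 2) ℂ} (h : StarCongruent A B)
    (hB : ∃ a : Canon, StarCongruent B a.mat) : ∃ a : Canon, StarCongruent A a.mat :=
  hB.imp fun _ ha => h.trans ha

theorem starCongruent_diag_scale {r s : ℝ} (hr : 0 < r) (hs : 0 < s) (α β : ℂ) :
    StarCongruent !![r * α, 0; 0, s * β] !![α, 0; 0, β] := by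
  have hr' : ((Real.sqrt r : ℝ) : ℂ) ≠ 0 := by exact_mod_cast (Real.sqrt_pos.2 hr).ne'
  have hs' : ((Real.sqrt s : ℝ) : ℂ) ≠ 0 := by exact_mod_cast (Real.sqrt_pos.2 hs).ne'
  have er : (r : ℂ) = (Real.sqrt r : ℂ) * (Real.sqrt r : ℂ) := by
    exact_mod_cast (Real.mul_self_sqrt hr.le).symm
  have es : (s : ℂ) = (Real.sqrt s : ℂ) * (Real.sqrt s : ℂ) := by
    exact_mod_cast (Real.mul_self_sqrt hs.le).symm
  rw [er, es]
  refine starCongruent_of_det_ne_zero (Real.sqrt r : ℂ)⁻¹ 0 0 (Real.sqrt s : ℂ)⁻¹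
    (by simpa using ⟨(Real.sqrt_pos.2 hr).ne', (Real.sqrt_pos.2 hs).ne'⟩) ?_
  ext i j
  fin_cases i <;> fin_cases j <;> simp [Matrix.mul_apply, Fin.sum_univ_two] <;> field_simp

theorem norm_div_norm_self {α : ℂ} (h : α ≠ 0) : ‖α / ‖α‖‖ = 1 := by
  have := norm_ne_zero_iff.2 h
  simp [this]

theorem norm_mul_div_norm (α : ℂ) : (‖α‖ : ℂ) * (α / ‖α‖) = α := by
  by_cases h : α = 0
  · simp [h]
  · have : (‖α‖ : ℂ) ≠ 0 := by exact_mod_cast norm_ne_zero_iff.2 h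
    field_simp

theorem exists_canon_diag_of_norm_one {μ ν : ℂ} (hμ : ‖μ‖ = 1) (hν : ‖ν‖ = 1) :
    ∃ a : Canon, StarCongruent !![μ, 0; 0, ν] a.mat := by
  by_cases h1 : μ = ν
  · subst h1
    exact ⟨.same μ hμ, .refl _⟩
  by_cases h2 : μ = -ν
  · subst h2
    exact ⟨.opp ν hν, starCongruent_diag_swap _ _⟩
  exact ⟨.generic μ ν hμ hν h1 h2, .refl _⟩

theorem exists_canon_diag (α β : ℂ) : ∃ a : Canon, StarCongruent !![α, 0; 0, β] a.mat := by
  have key : ∀ α : ℂ, ∃ a : Canon, StarCongruent !![α, 0; 0, 0] a.mat := by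
    intro α
    by_cases hα : α = 0
    · refine ⟨.zero, ?_⟩
      subst hα
      change StarCongruent _ (0 : Matrix (Fin 2) (Fin 2) ℂ)
      convert StarCongruent.refl (0 : Matrix (Fin 2) (Fin 2) ℂ) using 1
      ext i j
      fin_cases i <;> fin_cases j <;> rfl
    · refine ⟨.rankOne (α / ‖α‖) (norm_div_norm_self hα), ?_⟩
      have := starCongruent_diag_scale (norm_pos_iff.2 hα) one_pos (α / ‖α‖) 0
      rwa [norm_mul_div_norm, mul_zero] at this
  by_cases hα : α = 0
  · subst hα
    exact exists_canon_of_starCongruent (starCongruent_diag_swap _ _) (key β)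
  by_cases hβ : β = 0
  · subst hβ
    exact key α
  have := starCongruent_diag_scale (norm_pos_iff.2 hα) (norm_pos_iff.2 hβ) (α / ‖α‖) (β / ‖β‖)
  rw [norm_mul_div_norm, norm_mul_div_norm] at this
  exact exists_canon_of_starCongruent this
    (exists_canon_diag_of_norm_one (norm_div_norm_self hα) (norm_div_norm_self hβ))

theorem exists_canon_antidiag_of_lt {b c : ℂ} (h : ‖c‖ < ‖b‖) :
    ∃ a : Canon, StarCongruent !![0, b; c, 0] a.mat := by
  have hb : b ≠ 0 := norm_pos_iff.1 ((norm_nonneg c).trans_lt h)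
  refine ⟨.anti (conj b⁻¹ * c) ?_, ?_⟩
  · rw [norm_mul, Complex.norm_conj, norm_inv, inv_mul_lt_iff₀ (norm_pos_iff.2 hb), mul_one]
    exact h
  · refine starCongruent_of_det_ne_zero 1 0 0 b⁻¹ (by simpa using hb) ?_
    ext i j
    fin_cases i <;> fin_cases j <;> simp [Matrix.mul_apply, Fin.sum_univ_two, Canon.mat, hb]

theorem exists_canon_antidiag_of_ne {b c : ℂ} (h : ‖b‖ ≠ ‖c‖) :
    ∃ a : Canon, StarCongruent !![0, b; c, 0] a.mat := by
  rcases lt_or_gt_of_ne h with h | h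
  · refine exists_canon_of_starCongruent (starCongruent_of_det_ne_zero 0 1 1 0 (by norm_num) ?_)
      (exists_canon_antidiag_of_lt h)
    ext i j
    fin_cases i <;> fin_cases j <;> simp [Matrix.mul_apply, Fin.sum_univ_two]
  · exact exists_canon_antidiag_of_lt h

/-- Adding `z` times the first basis vector to the second changes `d` into `d + c z + b z̄`. This
real-linear expression can be made zero because `|b| ≠ |c|`; the upper right entry of the
transformation is the solution `z`. -/
theorem exists_canon_isotropic_of_ne {b c : ℂ} (d : ℂ) (h : ‖b‖ ≠ ‖c‖) :
    ∃ a : Canon, StarCongruent !![0, b; c, d] a.mat := by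
  have h0 : c * conj c - b * conj b ≠ 0 := by
    rw [Complex.mul_conj, Complex.mul_conj, Complex.normSq_eq_norm_sq, Complex.normSq_eq_norm_sq,
      ← Complex.ofReal_sub, Complex.ofReal_ne_zero, sub_ne_zero]
    intro h2
    exact h ((sq_eq_sq₀ (norm_nonneg _) (norm_nonneg _)).1 h2.symm)
  have h0' : conj c * c - conj b * b ≠ 0 := by rwa [mul_comm, mul_comm (conj b)]
  refine exists_canon_of_starCongruent (starCongruent_of_det_ne_zero 1
    ((b * conj d - conj c * d) / (c * conj c - b * conj b)) 0 1 (by norm_num) ?_)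
    (exists_canon_antidiag_of_ne h)
  ext i j
  fin_cases i <;> fin_cases j <;> simp [Matrix.mul_apply, Fin.sum_univ_two]
  have e : conj c * c - conj b * b = c * conj c - b * conj b := by ring
  rw [e]
  field_simp
  ring

theorem exists_canon_delta {τ : ℂ} (hτ : ‖τ‖ = 1) (q : ℝ) :
    ∃ a : Canon, StarCongruent !![0, τ; τ, τ * (q * Complex.I)] a.mat := by
  rcases lt_trichotomy q 0 with hq | rfl | hq
  · have h' : 0 < -q := by linarith
    have hs : ((Real.sqrt (-q) : ℝ) : ℂ) ≠ 0 := by exact_mod_cast (Real.sqrt_pos.2 h').ne'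
    have e : (q : ℂ) = -((Real.sqrt (-q) : ℂ) * (Real.sqrt (-q) : ℂ)) := by
      rw [← Complex.ofReal_mul, Real.mul_self_sqrt h'.le]; simp
    -- A negative `q` is absorbed into `-τ`: the minus sign on the second basis vector negates the
    -- off-diagonal entries, and the rescaling turns the corner into `-τ i`.
    refine ⟨.delta (-τ) (by rwa [norm_neg]), starCongruent_of_det_ne_zero (Real.sqrt (-q) : ℂ) 0 0
      (-(Real.sqrt (-q) : ℂ)⁻¹) (by simp [(Real.sqrt_pos.2 h').ne']) ?_⟩
    rw [e]
    ext i j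
    fin_cases i <;> fin_cases j <;> simp [Matrix.mul_apply, Fin.sum_univ_two, Canon.mat] <;>
      field_simp
  · refine ⟨.opp τ hτ, ?_⟩
    simpa [Canon.mat] using starCongruent_antidiag_opp τ
  · have hs : ((Real.sqrt q : ℝ) : ℂ) ≠ 0 := by exact_mod_cast (Real.sqrt_pos.2 hq).ne'
    have e : (q : ℂ) = (Real.sqrt q : ℂ) * (Real.sqrt q : ℂ) := by
      exact_mod_cast (Real.mul_self_sqrt hq.le).symm
    refine ⟨.delta τ hτ, starCongruent_of_det_ne_zero (Real.sqrt q : ℂ) 0 0 (Real.sqrt q : ℂ)⁻¹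
      (by simp [(Real.sqrt_pos.2 hq).ne']) ?_⟩
    rw [e]
    ext i j
    fin_cases i <;> fin_cases j <;> simp [Matrix.mul_apply, Fin.sum_univ_two, Canon.mat] <;>
      field_simp

/-- A real shift of the second basis vector by the first changes `d / τ` by an arbitrary real
number, so only its imaginary part survives. -/
theorem exists_canon_isotropic_symm {τ : ℂ} (hτ : ‖τ‖ = 1) (d : ℂ) :
    ∃ a : Canon, StarCongruent !![0, τ; τ, d] a.mat := by
  refine exists_canon_of_starCongruent (starCongruent_of_det_ne_zero 1
    (-((d * conj τ).re / 2 : ℝ)) 0 1 (by norm_num) ?_) (exists_canon_delta hτ (d * conj τ).im)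
  have h1 : d = τ * ((d * conj τ).re + (d * conj τ).im * Complex.I) := by
    rw [Complex.re_add_im, mul_comm, mul_assoc, conj_mul_self hτ, mul_one]
  generalize (d * conj τ).re = p at *
  generalize (d * conj τ).im = q at *
  subst h1
  have h2 : conj (2 : ℂ) = 2 := map_ofNat _ 2
  ext i j
  fin_cases i <;> fin_cases j <;> simp [Matrix.mul_apply, Fin.sum_univ_two, h2]
  ring

theorem exists_canon_isotropic (b c d : ℂ) :
    ∃ a : Canon, StarCongruent !![0, b; c, d] a.mat := by
  by_cases h : ‖b‖ = ‖c‖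
  swap
  · exact exists_canon_isotropic_of_ne d h
  by_cases hb : b = 0
  · subst hb
    have hc : c = 0 := by simpa using h.symm
    subst hc
    exact exists_canon_diag 0 d
  have hbn : ‖b‖ ≠ 0 := norm_ne_zero_iff.2 hb
  have hbn' : (‖b‖ : ℂ) ≠ 0 := by exact_mod_cast hbn
  -- Scaling the second basis vector by the unit number `w` turns `b`, `c` into `b w`, `c w̄`; these
  -- agree when `w² = c / b`.
  obtain ⟨w, hw⟩ := IsAlgClosed.exists_eq_mul_self (c / b)
  have hwn : ‖w‖ = 1 := by
    have := congrArg norm hw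
    rw [norm_div, norm_mul, ← h, div_self hbn] at this
    nlinarith [norm_nonneg w]
  have hw0 : w ≠ 0 := ne_zero_of_norm_one hwn
  have hc : c = w * w * b := by rw [← hw]; field_simp
  refine exists_canon_of_starCongruent (starCongruent_of_det_ne_zero 1 0 0 (w / ‖b‖)
    (by simp [hw0, hb]) (?_ : _ = !![0, b * w / ‖b‖; b * w / ‖b‖, conj (w / ‖b‖) * d * (w / ‖b‖)]))
    (exists_canon_isotropic_symm ?_ _)
  · subst hc
    ext i j
    fin_cases i <;> fin_cases j <;> simp [Matrix.mul_apply, Fin.sum_univ_two]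
    · ring
    · linear_combination (w * b / ‖b‖) * conj_mul_self hwn
  · simp [hwn, hbn]

theorem exists_starCongruent_of_form_eq_zero {A : Matrix (Fin 2) (Fin 2) ℂ} {x y : ℂ}
    (hxy : ¬(x = 0 ∧ y = 0)) (h : form A x y = 0) :
    ∃ b c d, StarCongruent A !![0, b; c, d] := by
  obtain ⟨u, v, huv⟩ : ∃ u v : ℂ, x * v - u * y ≠ 0 := by
    by_cases hx : x = 0
    · exact ⟨1, 0, by simpa using fun hy => hxy ⟨hx, hy⟩⟩
    · exact ⟨0, 1, by simpa using hx⟩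
  refine ⟨conj x * (A 0 0 * u + A 0 1 * v) + conj y * (A 1 0 * u + A 1 1 * v),
    conj u * (A 0 0 * x + A 0 1 * y) + conj v * (A 1 0 * x + A 1 1 * y),
    conj u * (A 0 0 * u + A 0 1 * v) + conj v * (A 1 0 * u + A 1 1 * v),
    starCongruent_of_det_ne_zero x u y v huv ?_⟩
  · ext i j
    fin_cases i <;> fin_cases j <;> simp [Matrix.mul_apply, Fin.sum_univ_two]
    · rw [← h, form]
      ring
    all_goals ring

/-- A kernel vector would be isotropic, so `A` is nonsingular. If `A v = z A* v`, a vector `w` with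
`w* A v = 0` also satisfies `v* A w = 0`, and `v`, `w` diagonalize the form. -/
theorem exists_diag_of_form_ne_zero {A : Matrix (Fin 2) (Fin 2) ℂ}
    (h : ∀ x y, form A x y = 0 → x = 0 ∧ y = 0) :
    ∃ α β, StarCongruent A !![α, 0; 0, β] := by
  have hdet : A.det ≠ 0 := by
    intro h0
    obtain ⟨v, hv, hA⟩ := Matrix.exists_mulVec_eq_zero_iff.2 h0
    have e0 := congrFun hA 0
    have e1 := congrFun hA 1
    simp only [Matrix.mulVec, dotProduct, Fin.sum_univ_two, Pi.zero_apply] at e0 e1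
    obtain ⟨h0, h1⟩ := h (v 0) (v 1) (by simp [form, e0, e1])
    apply hv
    ext i
    fin_cases i
    · exact h0
    · exact h1
  obtain ⟨z, hz⟩ := Module.End.exists_eigenvalue (Matrix.toLin' ((Aᴴ)⁻¹ * A))
  obtain ⟨v, hv⟩ := hz.exists_hasEigenvector
  have hv1 : ((Aᴴ)⁻¹ * A) *ᵥ v = z • v := hv.apply_eq_smul
  have hu : IsUnit (Aᴴ).det := by
    rw [Matrix.det_conjTranspose]
    simpa using hdet
  have hv2 : A *ᵥ v = z • (Aᴴ *ᵥ v) := by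
    rw [← Matrix.mulVec_smul, ← hv1, Matrix.mulVec_mulVec, ← Matrix.mul_assoc,
      Matrix.mul_nonsing_inv _ hu, Matrix.one_mul]
  have e0 := congrFun hv2 0
  have e1 := congrFun hv2 1
  simp only [Matrix.mulVec, dotProduct, Fin.sum_univ_two, Pi.smul_apply, smul_eq_mul,
    Matrix.conjTranspose_apply, Complex.star_def] at e0 e1
  have hf : form A (v 0) (v 1) ≠ 0 := by
    intro hf
    obtain ⟨h0, h1⟩ := h _ _ hf
    apply hv.2
    ext i
    fin_cases i
    · exact h0
    · exact h1
  generalize v 0 = p at *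
  generalize v 1 = q at *
  have c0 := congrArg conj e0
  have c1 := congrArg conj e1
  simp only [map_add, map_mul, Complex.conj_conj] at c0 c1
  -- The second column is `A v` rotated and conjugated, which makes it orthogonal to `A v`. The
  -- determinant of the pair is the conjugate of `form A p q`, hence nonzero.
  refine ⟨form A p q, form A (-conj (A 1 0 * p + A 1 1 * q)) (conj (A 0 0 * p + A 0 1 * q)),
    starCongruent_of_det_ne_zero p (-conj (A 1 0 * p + A 1 1 * q)) q
    (conj (A 0 0 * p + A 0 1 * q)) ?_ ?_⟩
  · intro h0
    apply hf
    rw [← map_eq_zero (starRingEnd ℂ), ← h0]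
    simp [form]
    ring
  · ext i j
    fin_cases i <;> fin_cases j <;> simp [Matrix.mul_apply, Fin.sum_univ_two, form]
    · ring
    · linear_combination (A 0 1 * conj p + A 1 1 * conj q) * c0
        - (A 0 0 * conj p + A 1 0 * conj q) * c1
    · ring
    · ring

theorem exists_canon (A : Matrix (Fin 2) (Fin 2) ℂ) : ∃ a : Canon, StarCongruent A a.mat := by
  by_cases h : ∀ x y, form A x y = 0 → x = 0 ∧ y = 0
  · obtain ⟨α, β, hA⟩ := exists_diag_of_form_ne_zero h
    exact exists_canon_of_starCongruent hA (exists_canon_diag α β)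
  · push Not at h
    obtain ⟨x, y, hf, hxy⟩ := h
    obtain ⟨b, c, d, hA⟩ := exists_starCongruent_of_form_eq_zero (fun h => hxy h.1 h.2) hf
    exact exists_canon_of_starCongruent hA (exists_canon_isotropic b c d)

/-! ### Codimensions -/

theorem finrank_tangentSpace_conj {n : ℕ} {A B : Matrix (Fin n) (Fin n) ℂ}
    (h : StarCongruent A B) :
    Module.finrank ℝ (tangentSpace B) ≤ Module.finrank ℝ (tangentSpace A) := by
  obtain ⟨S, hS, rfl⟩ := h
  obtain ⟨T, hT⟩ := hS.exists_left_inv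
  have hT' : Sᴴ * Tᴴ = 1 := by
    rw [← Matrix.conjTranspose_mul, hT, Matrix.conjTranspose_one]
  let f : Matrix (Fin n) (Fin n) ℂ →ₗ[ℝ] Matrix (Fin n) (Fin n) ℂ :=
    { toFun := fun X => Sᴴ * X * S
      map_add' := fun X Y => by rw [Matrix.mul_add, Matrix.add_mul]
      map_smul' := fun r X => by simp }
  have hle : tangentSpace (Sᴴ * A * S) ≤ (tangentSpace A).map f := by
    rintro _ ⟨C, rfl⟩
    -- Here `T = S⁻¹`: the tangent direction `C` at `S* A S` comes from `S C S⁻¹` at `A`.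
    refine ⟨_, ⟨S * C * T, rfl⟩, ?_⟩
    change Sᴴ * ((S * C * T)ᴴ * A + A * (S * C * T)) * S =
      Cᴴ * (Sᴴ * A * S) + (Sᴴ * A * S) * C
    rw [Matrix.conjTranspose_mul, Matrix.conjTranspose_mul, Matrix.mul_add, Matrix.add_mul]
    congr 1
    · calc _ = (Sᴴ * Tᴴ) * (Cᴴ * (Sᴴ * A * S)) := by simp only [Matrix.mul_assoc]
        _ = _ := by rw [hT', Matrix.one_mul]
    · calc _ = (Sᴴ * A * S) * C * (T * S) := by simp only [Matrix.mul_assoc]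
        _ = _ := by rw [hT, Matrix.mul_one]
  exact (Submodule.finrank_mono hle).trans (Submodule.finrank_map_le f _)

theorem realCodim_eq_of_starCongruent {n : ℕ} {A B : Matrix (Fin n) (Fin n) ℂ}
    (h : StarCongruent A B) : realCodim B = realCodim A := by
  rw [realCodim, realCodim,
    le_antisymm (finrank_tangentSpace_conj h) (finrank_tangentSpace_conj h.symm)]

/-- By rank-nullity, since `tangentMap A` is an endomorphism; each codimension is then found by
solving `X* A + A X = 0`. -/
theorem realCodim_eq_finrank_ker {n : ℕ} (A : Matrix (Fin n) (Fin n) ℂ) :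
    realCodim A = Module.finrank ℝ (LinearMap.ker (tangentMap A)) := by
  have := LinearMap.finrank_range_add_finrank_ker (tangentMap A)
  rw [realCodim, tangentSpace]
  omega

/-- A real-linear family of `2 × 2` matrices, given by its entries. -/
noncomputable def entriesMap {k : ℕ} (a b c d : (Fin k → ℝ) →ₗ[ℝ] ℂ) :
    (Fin k → ℝ) →ₗ[ℝ] Matrix (Fin 2) (Fin 2) ℂ where
  toFun t := !![a t, b t; c t, d t]
  map_add' s t := by
    ext i j; fin_cases i <;> fin_cases j <;> simp
  map_smul' r t := by
    ext i j; fin_cases i <;> fin_cases j <;> simp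

theorem realCodim_eq_of_param {A : Matrix (Fin 2) (Fin 2) ℂ} {k : ℕ}
    (f : (Fin k → ℝ) →ₗ[ℝ] Matrix (Fin 2) (Fin 2) ℂ)
    (hf : Function.Injective f) (h : ∀ X, X ∈ Set.range f ↔ Xᴴ * A + A * X = 0) :
    realCodim A = k := by
  have : LinearMap.range f = LinearMap.ker (tangentMap A) := by
    ext X
    rw [LinearMap.mem_ker]
    exact h X
  rw [realCodim_eq_finrank_ker, ← this, LinearMap.finrank_range_of_inj hf]
  simp

/-- The coordinate `t i`, as a complex number multiplied by `z`. -/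
noncomputable def coordMul {k : ℕ} (i : Fin k) (z : ℂ) : (Fin k → ℝ) →ₗ[ℝ] ℂ :=
  (LinearMap.toSpanSingleton ℝ ℂ z).comp (LinearMap.proj i)

theorem coordMul_apply {k : ℕ} (i : Fin k) (z : ℂ) (t : Fin k → ℝ) :
    coordMul i z t = t i * z := by
  simp [coordMul]

theorem tangent_eq_zero_iff (A X : Matrix (Fin 2) (Fin 2) ℂ) :
    Xᴴ * A + A * X = 0 ↔
      (conj (X 0 0) * A 0 0 + conj (X 1 0) * A 1 0 + (A 0 0 * X 0 0 + A 0 1 * X 1 0) = 0 ∧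
       conj (X 0 0) * A 0 1 + conj (X 1 0) * A 1 1 + (A 0 0 * X 0 1 + A 0 1 * X 1 1) = 0) ∧
      (conj (X 0 1) * A 0 0 + conj (X 1 1) * A 1 0 + (A 1 0 * X 0 0 + A 1 1 * X 1 0) = 0 ∧
       conj (X 0 1) * A 0 1 + conj (X 1 1) * A 1 1 + (A 1 0 * X 0 1 + A 1 1 * X 1 1) = 0) := by
  rw [← Matrix.ext_iff]
  simp [Fin.forall_fin_two, Matrix.mul_apply, Fin.sum_univ_two]

theorem mem_range_entriesMap {k : ℕ} {a b c d : (Fin k → ℝ) →ₗ[ℝ] ℂ}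
    {X : Matrix (Fin 2) (Fin 2) ℂ} :
    X ∈ Set.range (entriesMap a b c d) ↔
      ∃ t, (X 0 0 = a t ∧ X 0 1 = b t) ∧ (X 1 0 = c t ∧ X 1 1 = d t) := by
  refine exists_congr fun t => ?_
  rw [eq_comm, ← Matrix.ext_iff]
  simp [Fin.forall_fin_two, entriesMap]

theorem add_conj_eq_zero_iff (z : ℂ) : z + conj z = 0 ↔ z.re = 0 := by
  rw [Complex.add_conj]
  simp

theorem entriesMap_injective {k : ℕ} {a b c d : (Fin k → ℝ) →ₗ[ℝ] ℂ}
    (h : ∀ t, a t = 0 → b t = 0 → c t = 0 → d t = 0 → t = 0) :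
    Function.Injective (entriesMap a b c d) := by
  rw [injective_iff_map_eq_zero]
  intro t ht
  rw [← Matrix.ext_iff] at ht
  simp only [entriesMap, LinearMap.coe_mk, AddHom.coe_mk, Fin.forall_fin_two] at ht
  exact h t ht.1.1 ht.1.2 ht.2.1 ht.2.2

theorem realCodim_generic {μ ν : ℂ} (hμ : ‖μ‖ = 1) (hν : ‖ν‖ = 1) (h : μ ≠ ν) (h' : μ ≠ -ν) :
    realCodim !![μ, 0; 0, ν] = 2 := by
  have hμ0 := ne_zero_of_norm_one hμ
  have hν0 := ne_zero_of_norm_one hν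
  refine realCodim_eq_of_param
    (entriesMap (coordMul 0 Complex.I) 0 0 (coordMul 1 Complex.I)) ?_ fun X => ?_
  · refine entriesMap_injective fun t h1 _ _ h2 => ?_
    ext i
    fin_cases i
    · simpa [coordMul_apply] using h1
    · simpa [coordMul_apply] using h2
  · rw [mem_range_entriesMap, tangent_eq_zero_iff]
    simp only [coordMul_apply, LinearMap.zero_apply]
    constructor
    · rintro ⟨t, ⟨h1, h2⟩, h3, h4⟩
      simp [h1, h2, h3, h4]
      constructor <;> ring
    · rintro ⟨⟨h1, h2⟩, h3, h4⟩
      simp at h1 h2 h3 h4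
      have h1' : X 0 0 + conj (X 0 0) = 0 := by
        apply mul_left_cancel₀ hμ0; linear_combination h1
      have h4' : X 1 1 + conj (X 1 1) = 0 := by
        apply mul_left_cancel₀ hν0; linear_combination h4
      rw [add_conj_eq_zero_iff] at h1' h4'
      have hb : X 0 1 = 0 := by
        have e := congrArg conj h3
        simp only [map_add, map_mul, Complex.conj_conj, map_zero] at e
        -- This is the determinant of the linear system for `X 0 1` and the conjugate of `X 1 0`; it
        -- equals `2i Im (μ ν̄)`.
        have hne : (μ * conj ν - conj μ * ν) ≠ 0 := by
          intro h0
          apply mul_conj_im_ne_zero hμ hν h h'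
          have := congrArg Complex.im h0
          simp at this ⊢
          linarith
        apply mul_left_cancel₀ hne
        linear_combination conj ν * h2 - ν * e
      have hc : X 1 0 = 0 := by
        rw [hb] at h2
        simpa [hν0] using h2
      exact ⟨![(X 0 0).im, (X 1 1).im], ⟨Complex.ext (by simp [h1']) (by simp), hb⟩, hc,
        Complex.ext (by simp [h4']) (by simp)⟩

theorem realCodim_anti {σ : ℂ} (hσ : ‖σ‖ < 1) : realCodim !![0, 1; σ, 0] = 2 := by
  have hne : (1 - Complex.normSq σ : ℝ) ≠ 0 := by
    rw [Complex.normSq_eq_norm_sq]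
    nlinarith [norm_nonneg σ]
  have hne' : (1 - σ * conj σ) ≠ 0 := by
    rw [Complex.mul_conj]
    exact_mod_cast hne
  -- Both off-diagonal entries of `X` are governed by this equation, whose only solution is zero
  -- because `|σ| < 1`.
  have key : ∀ z : ℂ, z + σ * conj z = 0 → z = 0 := by
    intro z hz
    have e := congrArg conj hz
    simp only [map_add, map_mul, Complex.conj_conj, map_zero] at e
    apply mul_left_cancel₀ hne'
    linear_combination hz - σ * e
  refine realCodim_eq_of_param (entriesMap (coordMul 0 1 + coordMul 1 Complex.I) 0 0
    (coordMul 0 (-1) + coordMul 1 Complex.I)) ?_ fun X => ?_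
  · refine entriesMap_injective fun t h1 _ _ _ => ?_
    have h1r := congrArg Complex.re h1
    have h1i := congrArg Complex.im h1
    ext i
    fin_cases i
    · simpa [coordMul_apply] using h1r
    · simpa [coordMul_apply] using h1i
  · rw [mem_range_entriesMap, tangent_eq_zero_iff]
    simp only [coordMul_apply, LinearMap.zero_apply, LinearMap.add_apply]
    constructor
    · rintro ⟨t, ⟨h1, h2⟩, h3, h4⟩
      simp [h1, h2, h3, h4]
      constructor <;> ring
    · rintro ⟨⟨h1, h2⟩, h3, h4⟩
      simp at h1 h2 h3 h4
      have hc : X 1 0 = 0 := key _ (by linear_combination h1)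
      have hb : X 0 1 = 0 := by
        have := key (conj (X 0 1)) (by rw [Complex.conj_conj]; linear_combination h4)
        simpa using this
      have hd : X 1 1 = -conj (X 0 0) := by linear_combination h2
      exact ⟨![(X 0 0).re, (X 0 0).im], ⟨Complex.ext (by simp) (by simp), hb⟩, hc,
        Complex.ext (by simp [hd]) (by simp [hd])⟩

theorem realCodim_delta {τ : ℂ} (hτ : ‖τ‖ = 1) :
    realCodim !![0, τ; τ, τ * Complex.I] = 2 := by
  have hτ0 := ne_zero_of_norm_one hτ
  refine realCodim_eq_of_param (entriesMap (coordMul 0 Complex.I) (coordMul 1 Complex.I) 0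
    (coordMul 0 Complex.I)) ?_ fun X => ?_
  · refine entriesMap_injective fun t h1 h2 _ _ => ?_
    ext i
    fin_cases i
    · simpa [coordMul_apply] using h1
    · simpa [coordMul_apply] using h2
  · rw [mem_range_entriesMap, tangent_eq_zero_iff]
    simp only [coordMul_apply, LinearMap.zero_apply]
    constructor
    · rintro ⟨t, ⟨h1, h2⟩, h3, h4⟩
      simp [h1, h2, h3, h4]
      constructor <;> ring
    · rintro ⟨⟨h1, h2⟩, h3, h4⟩
      simp at h1 h2 h3 h4
      have h1' : X 1 0 + conj (X 1 0) = 0 := by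
        apply mul_left_cancel₀ hτ0; linear_combination h1
      have h2' : conj (X 0 0) + conj (X 1 0) * Complex.I + X 1 1 = 0 := by
        apply mul_left_cancel₀ hτ0; linear_combination h2
      have h3' : conj (X 1 1) + X 0 0 + Complex.I * X 1 0 = 0 := by
        apply mul_left_cancel₀ hτ0; linear_combination h3
      have h4' : X 0 1 + conj (X 0 1) + Complex.I * (X 1 1 + conj (X 1 1)) = 0 := by
        apply mul_left_cancel₀ hτ0; linear_combination h4
      rw [Complex.ext_iff] at h1' h2' h3' h4'
      simp at h1' h2' h3' h4'
      refine ⟨![(X 0 0).im, (X 0 1).im], ⟨Complex.ext ?_ ?_, Complex.ext ?_ ?_⟩,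
        Complex.ext ?_ ?_, Complex.ext ?_ ?_⟩ <;> simp <;> linarith

theorem realCodim_same {l : ℂ} (hl : ‖l‖ = 1) : realCodim !![l, 0; 0, l] = 4 := by
  have hl0 := ne_zero_of_norm_one hl
  refine realCodim_eq_of_param (entriesMap (coordMul 0 Complex.I)
    (coordMul 1 1 + coordMul 2 Complex.I) (coordMul 1 (-1) + coordMul 2 Complex.I)
    (coordMul 3 Complex.I)) ?_ fun X => ?_
  · refine entriesMap_injective fun t h1 h2 _ h3 => ?_
    have h2r := congrArg Complex.re h2
    have h2i := congrArg Complex.im h2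
    ext i
    fin_cases i
    · simpa [coordMul_apply] using h1
    · simpa [coordMul_apply] using h2r
    · simpa [coordMul_apply] using h2i
    · simpa [coordMul_apply] using h3
  · rw [mem_range_entriesMap, tangent_eq_zero_iff]
    simp only [coordMul_apply, LinearMap.add_apply]
    constructor
    · rintro ⟨t, ⟨h1, h2⟩, h3, h4⟩
      simp [h1, h2, h3, h4]
      refine ⟨⟨?_, ?_⟩, ?_, ?_⟩ <;> ring
    · rintro ⟨⟨h1, h2⟩, h3, h4⟩
      simp at h1 h2 h3 h4
      have h1' : X 0 0 + conj (X 0 0) = 0 := by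
        apply mul_left_cancel₀ hl0; linear_combination h1
      have h2' : X 0 1 + conj (X 1 0) = 0 := by
        apply mul_left_cancel₀ hl0; linear_combination h2
      have h4' : X 1 1 + conj (X 1 1) = 0 := by
        apply mul_left_cancel₀ hl0; linear_combination h4
      rw [Complex.ext_iff] at h1' h2' h4'
      simp at h1' h2' h4'
      refine ⟨![(X 0 0).im, (X 0 1).re, (X 0 1).im, (X 1 1).im],
        ⟨Complex.ext ?_ ?_, Complex.ext ?_ ?_⟩,
        Complex.ext ?_ ?_, Complex.ext ?_ ?_⟩ <;> simp <;> linarith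

theorem realCodim_opp {l : ℂ} (hl : ‖l‖ = 1) : realCodim !![l, 0; 0, -l] = 4 := by
  have hl0 := ne_zero_of_norm_one hl
  refine realCodim_eq_of_param (entriesMap (coordMul 0 Complex.I)
    (coordMul 1 1 + coordMul 2 Complex.I) (coordMul 1 1 + coordMul 2 (-Complex.I))
    (coordMul 3 Complex.I)) ?_ fun X => ?_
  · refine entriesMap_injective fun t h1 h2 _ h3 => ?_
    have h2r := congrArg Complex.re h2
    have h2i := congrArg Complex.im h2
    ext i
    fin_cases i
    · simpa [coordMul_apply] using h1
    · simpa [coordMul_apply] using h2r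
    · simpa [coordMul_apply] using h2i
    · simpa [coordMul_apply] using h3
  · rw [mem_range_entriesMap, tangent_eq_zero_iff]
    simp only [coordMul_apply, LinearMap.add_apply]
    constructor
    · rintro ⟨t, ⟨h1, h2⟩, h3, h4⟩
      simp [h1, h2, h3, h4]
      refine ⟨⟨?_, ?_⟩, ?_, ?_⟩ <;> ring
    · rintro ⟨⟨h1, h2⟩, h3, h4⟩
      simp at h1 h2 h3 h4
      have h1' : X 0 0 + conj (X 0 0) = 0 := by
        apply mul_left_cancel₀ hl0; linear_combination h1
      have h2' : X 0 1 - conj (X 1 0) = 0 := by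
        apply mul_left_cancel₀ hl0; linear_combination h2
      have h4' : X 1 1 + conj (X 1 1) = 0 := by
        apply mul_left_cancel₀ hl0; linear_combination -h4
      rw [Complex.ext_iff] at h1' h2' h4'
      simp at h1' h2' h4'
      refine ⟨![(X 0 0).im, (X 0 1).re, (X 0 1).im, (X 1 1).im],
        ⟨Complex.ext ?_ ?_, Complex.ext ?_ ?_⟩,
        Complex.ext ?_ ?_, Complex.ext ?_ ?_⟩ <;> simp <;> linarith

theorem realCodim_rankOne {l : ℂ} (hl : ‖l‖ = 1) : realCodim !![l, 0; 0, 0] = 5 := by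
  have hl0 := ne_zero_of_norm_one hl
  refine realCodim_eq_of_param (entriesMap (coordMul 0 Complex.I) 0
    (coordMul 1 1 + coordMul 2 Complex.I) (coordMul 3 1 + coordMul 4 Complex.I)) ?_ fun X => ?_
  · refine entriesMap_injective fun t h1 _ h2 h3 => ?_
    have h2r := congrArg Complex.re h2
    have h2i := congrArg Complex.im h2
    have h3r := congrArg Complex.re h3
    have h3i := congrArg Complex.im h3
    ext i
    fin_cases i
    · simpa [coordMul_apply] using h1
    · simpa [coordMul_apply] using h2r
    · simpa [coordMul_apply] using h2i
    · simpa [coordMul_apply] using h3r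
    · simpa [coordMul_apply] using h3i
  · rw [mem_range_entriesMap, tangent_eq_zero_iff]
    simp only [coordMul_apply, LinearMap.add_apply, LinearMap.zero_apply]
    constructor
    · rintro ⟨t, ⟨h1, h2⟩, h3, h4⟩
      simp [h1, h2, h3, h4]
      ring
    · rintro ⟨⟨h1, h2⟩, h3, h4⟩
      simp at h1 h2 h3 h4
      have h1' : X 0 0 + conj (X 0 0) = 0 := by
        apply mul_left_cancel₀ hl0; linear_combination h1
      rw [add_conj_eq_zero_iff] at h1'
      refine ⟨![(X 0 0).im, (X 1 0).re, (X 1 0).im, (X 1 1).re, (X 1 1).im],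
        ⟨Complex.ext ?_ ?_, ?_⟩,
        Complex.ext ?_ ?_, Complex.ext ?_ ?_⟩ <;> simp_all

theorem realCodim_zero : realCodim (0 : Matrix (Fin 2) (Fin 2) ℂ) = 8 := by
  have h : tangentMap (0 : Matrix (Fin 2) (Fin 2) ℂ) = 0 := by
    ext1 X
    simp [tangentMap]
  rw [realCodim_eq_finrank_ker, h, LinearMap.ker_zero, finrank_top, Module.finrank_matrix,
    Complex.finrank_real_complex]
  simp

theorem realCodim_eq_level (a : Canon) {A : Matrix (Fin 2) (Fin 2) ℂ} (hA : A ∈ starClass a.mat) :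
    realCodim A = a.level := by
  rw [realCodim_eq_of_starCongruent hA]
  cases a with
  | generic μ ν hμ hν h h' => exact realCodim_generic hμ hν h h'
  | anti σ hσ => exact realCodim_anti hσ
  | delta τ hτ => exact realCodim_delta hτ
  | same l hl => exact realCodim_same hl
  | opp l hl => exact realCodim_opp hl
  | rankOne l hl => exact realCodim_rankOne hl
  | zero => exact realCodim_zero

/-! ### Arrows give closure inclusions -/

theorem starCongruent_of_perm {a b : Canon} (h : Canon.Perm a b) : StarCongruent a.mat b.mat := by
  cases h with
  | refl => exact .refl _
  | swapGeneric μ ν => exact starCongruent_diag_swap μ ν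
  | swapOpp l hl hl' =>
    have := starCongruent_diag_swap l (-l)
    simpa [Canon.mat] using this

theorem vertexClass_vertex (a : Canon) : vertexClass a.vertex = starClass a.mat := by
  ext X
  constructor
  · rintro ⟨b, hb, hX⟩
    exact (starCongruent_of_perm (Quotient.exact hb)).symm.trans hX
  · exact fun hX => ⟨a, rfl, hX⟩

theorem exists_vertex_eq (v : Vertex) : ∃ a : Canon, a.vertex = v := Quotient.exists_rep v

theorem vertexClass_subset_closure_iff (a b : Canon) :
    vertexClass a.vertex ⊆ closure (vertexClass b.vertex) ↔ a.mat ∈ closure (starClass b.mat) := by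
  rw [vertexClass_vertex, vertexClass_vertex]
  exact ⟨fun h => h (mem_starClass_self _), starClass_subset_closure⟩

theorem mem_closure_of_arrow {a b : Canon} (h : Canon.Arrow a b) :
    a.mat ∈ closure (starClass b.mat) := by
  cases h with
  | zero_rankOne => exact zero_mem_closure _
  | zero_generic => exact zero_mem_closure _
  | zero_delta => exact zero_mem_closure _
  | rankOne_same l hl =>
    exact rankOne_mem_closure (ne_zero_of_norm_one hl) 1 0 (by simp [form, Canon.mat])
  | rankOne_opp l hl => exact rankOne_mem_closure_opp hl (.inl rfl)
  | rankOne_generic l μ ν hl hμ hν h1 h2 h =>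
    obtain ⟨x, y, hxy⟩ := exists_form_generic h
    exact rankOne_mem_closure (ne_zero_of_norm_one hl) x y hxy
  | rankOne_anti l σ hl hσ =>
    obtain ⟨x, y, hxy⟩ := exists_form_anti hσ l
    exact rankOne_mem_closure (ne_zero_of_norm_one hl) x y hxy
  | rankOne_delta l τ hl hτ h => exact rankOne_mem_closure_delta hl hτ h
  | opp_delta l τ hl hτ h => exact opp_mem_closure_delta_of_eq h

theorem vertexClass_subset_of_adj {v w : Vertex} (h : graphTwo.Adj v w) :
    vertexClass v ⊆ closure (vertexClass w) := by
  obtain ⟨a, b, rfl, rfl, h⟩ := h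
  exact (vertexClass_subset_closure_iff a b).2 (mem_closure_of_arrow h)

theorem vertexClass_subset_of_path {v w : Vertex} (h : Relation.ReflTransGen graphTwo.Adj v w) :
    vertexClass v ⊆ closure (vertexClass w) := by
  induction h with
  | refl => exact subset_closure
  | tail _ h ih => exact ih.trans (closure_minimal (vertexClass_subset_of_adj h) isClosed_closure)

theorem adj_of_arrow {a b : Canon} (h : Canon.Arrow a b) : graphTwo.Adj a.vertex b.vertex :=
  ⟨a, b, rfl, rfl, h⟩

theorem vertex_opp_neg {l : ℂ} (hl : ‖l‖ = 1) (hl' : ‖-l‖ = 1) :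
    (Canon.opp l hl).vertex = (Canon.opp (-l) hl').vertex :=
  Quotient.sound (Canon.Perm.swapOpp l hl hl')

theorem adj_rankOne_opp {l m : ℂ} (hl : ‖l‖ = 1) (hm : ‖m‖ = 1) (h : l = m ∨ l = -m) :
    graphTwo.Adj (Canon.rankOne l hl).vertex (Canon.opp m hm).vertex := by
  rcases h with rfl | rfl
  · exact adj_of_arrow (.rankOne_opp l hl)
  · rw [vertex_opp_neg hm hl]
    exact adj_of_arrow (.rankOne_opp _ _)

theorem cone_of_rankOne_mem_closure {l μ ν : ℂ} (hμ : ‖μ‖ = 1) (hν : ‖ν‖ = 1) (h1 : μ ≠ ν)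
    (h2 : μ ≠ -ν) (h : !![l, 0; 0, 0] ∈ closure (starClass !![μ, 0; 0, ν])) :
    ∃ a b : ℝ, 0 ≤ a ∧ 0 ≤ b ∧ l = μ * a + ν * b := by
  have hf := form_im_generic h 1 0
  have e : form !![l, 0; 0, 0] 1 0 = l := by simp [form]
  rw [e] at hf
  exact mem_cone_of_im (mul_conj_im_ne_zero hμ hν h1 h2) hf.1 hf.2

theorem im_nonneg_of_rankOne_mem_closure {l τ : ℂ} (hτ : ‖τ‖ = 1)
    (h : !![l, 0; 0, 0] ∈ closure (starClass !![0, τ; τ, τ * Complex.I])) :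
    0 ≤ (l * conj τ).im := by
  have hf := form_im_delta hτ h 1 0
  rwa [show form !![l, 0; 0, 0] 1 0 = l by simp [form]] at hf

theorem eq_of_rankOne_mem_closure_same {l m : ℂ} (hl : ‖l‖ = 1) (hm : ‖m‖ = 1)
    (h : !![l, 0; 0, 0] ∈ closure (starClass !![m, 0; 0, m])) : l = m :=
  eq_of_form_diag hl hm (mul_conj_im_self m) (by rw [mul_conj_self hm]; simp) rfl h

theorem eq_or_eq_neg_of_rankOne_mem_closure_opp {l m : ℂ} (hl : ‖l‖ = 1) (hm : ‖m‖ = 1)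
    (h : !![l, 0; 0, 0] ∈ closure (starClass !![m, 0; 0, -m])) : l = m ∨ l = -m := by
  have hf := form_real_of_diag (by rw [neg_mul, Complex.neg_im, mul_conj_im_self, neg_zero]) h 1 0
  rw [show form !![l, 0; 0, 0] 1 0 = l by simp [form]] at hf
  exact eq_or_eq_neg_of_im_eq_zero hl hm hf

/-! ### Closure inclusions give paths -/

namespace Canon

/-- The absolute value of the determinant. -/
noncomputable def detNorm : Canon → ℝ
  | generic _ _ _ _ _ _ => 1
  | anti σ _ => ‖σ‖
  | delta _ _ => 1
  | same _ _ => 1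
  | opp _ _ => 1
  | rankOne _ _ => 0
  | zero => 0

/-- The value of `cross`. -/
noncomputable def crossRe : Canon → ℝ
  | generic μ ν _ _ _ _ => 2 * (μ * conj ν).re
  | anti σ _ => -(1 + ‖σ‖ ^ 2)
  | delta _ _ => -2
  | same _ _ => 2
  | opp _ _ => -2
  | rankOne _ _ => 0
  | zero => 0

theorem norm_det_mat (a : Canon) : ‖a.mat.det‖ = a.detNorm := by
  cases a <;> simp_all [mat, detNorm, Matrix.det_fin_two]

theorem cross_mat (a : Canon) : cross a.mat = a.crossRe := by
  cases a with
  | generic μ ν =>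
    have := Complex.add_conj (μ * conj ν)
    simp only [map_mul, Complex.conj_conj] at this
    rw [crossRe, ← this]
    simp [mat, cross]
  | anti σ =>
    simp [mat, crossRe, cross, Complex.mul_conj, Complex.normSq_eq_norm_sq]
    ring
  | delta τ hτ =>
    simp [mat, crossRe, cross, mul_conj_self hτ]
    norm_num
  | same l hl =>
    simp [mat, crossRe, cross, mul_conj_self hl, conj_mul_self hl]
    norm_num
  | opp l hl =>
    simp [mat, crossRe, cross, mul_conj_self hl, conj_mul_self hl]
    norm_num
  | rankOne => simp [mat, crossRe, cross]
  | zero => simp [mat, crossRe, cross]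

theorem exists_ray {a b : Canon} (h : a.mat ∈ closure (starClass b.mat)) :
    ∃ r : ℝ, 0 ≤ r ∧ a.detNorm = r * b.detNorm ∧ a.crossRe = r * b.crossRe ∧
      a.mat.det = r * b.mat.det := by
  obtain ⟨r, hr, h1, h2⟩ := exists_ray_of_mem_closure h
  refine ⟨r, hr, ?_, ?_, h1⟩
  · rw [← norm_det_mat, ← norm_det_mat, h1, norm_mul, Complex.norm_real, Real.norm_of_nonneg hr]
  · rw [cross_mat, cross_mat] at h2
    exact_mod_cast h2

theorem abs_crossRe_generic {μ ν : ℂ} (hμ : ‖μ‖ = 1) (hν : ‖ν‖ = 1) (h1 : μ ≠ ν) (h2 : μ ≠ -ν) :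
    -2 < 2 * (μ * conj ν).re ∧ 2 * (μ * conj ν).re < 2 := by
  have him := mul_conj_im_ne_zero hμ hν h1 h2
  have hn : ‖μ * conj ν‖ = 1 := by simp [hμ, hν]
  have hs := Complex.normSq_eq_norm_sq (μ * conj ν)
  rw [hn, Complex.normSq_apply] at hs
  have := mul_self_pos.2 him
  constructor <;> nlinarith

end Canon

/-- Since `(μ + ν)² = μν (2 Re (μ ν̄) + 2)`, the sum is determined up to sign, and with the product
it determines the unordered pair up to a common sign. The opposite pair spans the opposite cone,
which the closure hypothesis rules out. -/
theorem generic_vertex_eq {μ ν μ' ν' : ℂ} (hμ : ‖μ‖ = 1) (hν : ‖ν‖ = 1) (h1 : μ ≠ ν)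
    (h2 : μ ≠ -ν) (hμ' : ‖μ'‖ = 1) (hν' : ‖ν'‖ = 1) (h1' : μ' ≠ ν') (h2' : μ' ≠ -ν')
    (hdet : μ * ν = μ' * ν') (hre : (μ * conj ν).re = (μ' * conj ν').re)
    (h : !![μ, 0; 0, ν] ∈ closure (starClass !![μ', 0; 0, ν'])) :
    (Canon.generic μ ν hμ hν h1 h2).vertex = (Canon.generic μ' ν' hμ' hν' h1' h2').vertex := by
  have key : ∀ {μ ν : ℂ}, ‖μ‖ = 1 → ‖ν‖ = 1 →
      (μ + ν) ^ 2 = μ * ν * (2 * (μ * conj ν).re + 2 : ℝ) := by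
    intro μ ν hμ hν
    have e := Complex.add_conj (μ * conj ν)
    simp only [map_mul, Complex.conj_conj] at e
    push_cast at e ⊢
    rw [← e]
    linear_combination (-μ ^ 2) * mul_conj_self hν - ν ^ 2 * mul_conj_self hμ
  have hsq : (μ + ν) ^ 2 = (μ' + ν') ^ 2 := by rw [key hμ hν, key hμ' hν', hdet, hre]
  rcases sq_eq_sq_iff_eq_or_eq_neg.1 hsq with hs | hs
  · have : (μ - μ') * (μ - ν') = 0 := by linear_combination μ * hs - hdet
    rcases mul_eq_zero.1 this with h0 | h0
    · obtain rfl := sub_eq_zero.1 h0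
      obtain rfl := add_left_cancel hs
      rfl
    · obtain rfl := sub_eq_zero.1 h0
      have : ν = μ' := by linear_combination hs
      subst this
      exact Quotient.sound (Canon.Perm.swapGeneric ..)
  · exfalso
    have hne := mul_conj_im_ne_zero hμ' hν' h1' h2'
    have hpos := mul_self_pos.2 hne
    have e : form !![μ, 0; 0, ν] 1 0 = μ := by simp [form]
    have hf := form_im_generic h 1 0
    rw [e] at hf
    have : (μ + μ') * (μ + ν') = 0 := by linear_combination μ * hs - hdet
    rcases mul_eq_zero.1 this with h0 | h0
    · have hf := hf.1
      rw [eq_neg_of_add_eq_zero_left h0, neg_mul, Complex.neg_im] at hf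
      linarith
    · have hf := hf.2
      rw [eq_neg_of_add_eq_zero_left h0, neg_mul, Complex.neg_im, mul_conj_im_swap] at hf
      linarith

/-- The determinants leave `τ = ±τ'`; the value `τ i` must lie in the half-plane of `τ'`, which
excludes the minus sign. -/
theorem delta_eq_of_mem_closure {τ τ' : ℂ} (hτ' : ‖τ'‖ = 1)
    (hdet : τ * τ = τ' * τ')
    (h : !![0, τ; τ, τ * Complex.I] ∈ closure (starClass !![0, τ'; τ', τ' * Complex.I])) :
    τ = τ' := by
  rcases mul_self_eq_mul_self_iff.1 hdet with h1 | h1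
  · exact h1
  · have hf := form_im_delta hτ' h 0 1
    rw [show form !![0, τ; τ, τ * Complex.I] 0 1 = τ * Complex.I by simp [form], h1,
      mul_right_comm, neg_mul, mul_conj_self hτ'] at hf
    norm_num at hf

theorem path_of_mem_closure {a b : Canon} (h : a.mat ∈ closure (starClass b.mat)) :
    Relation.ReflTransGen graphTwo.Adj a.vertex b.vertex := by
  have refl_of_eq : a.vertex = b.vertex → Relation.ReflTransGen graphTwo.Adj a.vertex b.vertex :=
    fun h => h ▸ .refl
  obtain ⟨r, hr, hd, hc, hdet⟩ := Canon.exists_ray h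
  cases a with
  | zero =>
    cases b with
    | zero => exact .refl
    | rankOne l hl => exact .single (adj_of_arrow (.zero_rankOne l hl))
    | generic μ ν hμ hν h1 h2 => exact .single (adj_of_arrow (.zero_generic μ ν hμ hν h1 h2))
    | delta τ hτ => exact .single (adj_of_arrow (.zero_delta τ hτ))
    | anti σ hσ =>
      -- There is no direct arrow; any `diag(l, 0)` serves as the midpoint.
      exact .head (adj_of_arrow (.zero_rankOne 1 norm_one))
        (.single (adj_of_arrow (.rankOne_anti 1 σ norm_one hσ)))
    | same l hl =>
      exact .head (adj_of_arrow (.zero_rankOne l hl))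
        (.single (adj_of_arrow (.rankOne_same l hl)))
    | opp l hl =>
      exact .head (adj_of_arrow (.zero_rankOne l hl))
        (.single (adj_of_arrow (.rankOne_opp l hl)))
  | rankOne l hl =>
    cases b with
    | zero =>
      have := form_mem_of_mem_closure (K := {0}) isClosed_singleton
        (by simp [form, Canon.mat]) h 1 0
      simp [form, Canon.mat] at this
      simp [this] at hl
    | rankOne m hm =>
      obtain rfl : l = m := eq_of_form_diag hl hm (by simp) (by simp) rfl h
      exact .refl
    | generic μ ν hμ hν h1 h2 =>
      exact .single (adj_of_arrow (.rankOne_generic l μ ν hl hμ hν h1 h2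
        (cone_of_rankOne_mem_closure hμ hν h1 h2 h)))
    | delta τ hτ =>
      exact .single (adj_of_arrow (.rankOne_delta l τ hl hτ
        (im_nonneg_of_rankOne_mem_closure hτ h)))
    | anti σ hσ => exact .single (adj_of_arrow (.rankOne_anti l σ hl hσ))
    | same m hm =>
      obtain rfl := eq_of_rankOne_mem_closure_same hl hm h
      exact .single (adj_of_arrow (.rankOne_same l hl))
    | opp m hm =>
      exact .single (adj_rankOne_opp hl hm (eq_or_eq_neg_of_rankOne_mem_closure_opp hl hm h))
  | generic μ ν hμ hν h1 h2 =>
    have hb := Canon.abs_crossRe_generic hμ hν h1 h2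
    cases b with
    | generic μ' ν' hμ' hν' h1' h2' =>
      simp only [Canon.detNorm, Canon.crossRe, mul_one] at hd hc
      subst hd
      refine refl_of_eq (generic_vertex_eq _ _ _ _ _ _ _ _ ?_ (by linarith) h)
      simpa [Canon.mat, Matrix.det_fin_two] using hdet
    | anti σ hσ =>
      simp only [Canon.detNorm, Canon.crossRe] at hd hc
      -- From `r |σ| = 1` and `(1 - |σ|)² ≥ 0` the target would force `cross ≤ -2`, while generic
      -- matrices have `cross > -2`.
      nlinarith [norm_nonneg σ, mul_nonneg hr (sq_nonneg (1 - ‖σ‖))]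
    | _ => simp only [Canon.detNorm, Canon.crossRe] at hd hc; exfalso; nlinarith
  | anti σ hσ =>
    have hs := norm_nonneg σ
    cases b with
    | generic μ ν hμ hν h1 h2 =>
      have hb := Canon.abs_crossRe_generic hμ hν h1 h2
      simp only [Canon.detNorm, Canon.crossRe, mul_one] at hd hc
      subst hd
      nlinarith
    | anti σ' hσ' =>
      have hs' := norm_nonneg σ'
      simp only [Canon.detNorm, Canon.crossRe] at hd hc
      -- Eliminating `r` equates the values of `s / (1 + s²)` at the two moduli; this function is
      -- injective on `[0, 1)`.
      have e : (‖σ‖ - ‖σ'‖) * (1 - ‖σ‖ * ‖σ'‖) = 0 := by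
        linear_combination (1 + ‖σ'‖ ^ 2) * hd + ‖σ'‖ * hc
      have hn : ‖σ‖ = ‖σ'‖ := by
        rcases mul_eq_zero.1 e with e | e <;> nlinarith
      have hr1 : r = 1 := by
        rw [hn] at hc
        have : (1 - r) * (1 + ‖σ'‖ ^ 2) = 0 := by linear_combination -hc
        rcases mul_eq_zero.1 this with e | e
        · linarith
        · nlinarith
      subst hr1
      have : σ = σ' := by simpa [Canon.mat, Matrix.det_fin_two] using hdet
      subst this
      exact .refl
    | _ =>
      simp only [Canon.detNorm, Canon.crossRe, mul_one, mul_zero] at hd hc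
      exfalso
      try subst hd
      nlinarith
  | delta τ hτ =>
    cases b with
    | generic μ ν hμ hν h1 h2 =>
      have hb := Canon.abs_crossRe_generic hμ hν h1 h2
      simp only [Canon.detNorm, Canon.crossRe] at hd hc
      nlinarith
    | anti σ hσ =>
      simp only [Canon.detNorm, Canon.crossRe] at hd hc
      have : 0 < r := by rcases hr.lt_or_eq with h | h <;> [exact h; (subst h; linarith)]
      -- `r |σ| = 1` and `r (1 + |σ|²) = 2` would give `r (1 - |σ|)² = 0`.
      nlinarith [norm_nonneg σ, mul_pos this (pow_pos (sub_pos.2 hσ) 2)]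
    | delta τ' hτ' =>
      simp only [Canon.detNorm, Canon.crossRe, mul_one] at hd hc
      subst hd
      obtain rfl := delta_eq_of_mem_closure hτ'
        (by simpa [Canon.mat, Matrix.det_fin_two] using hdet) h
      exact .refl
    | opp l hl =>
      exfalso
      simp only [Canon.detNorm, Canon.crossRe, mul_one] at hd hc
      subst hd
      have h2 : τ * τ = l * l := by simpa [Canon.mat, Matrix.det_fin_two] using hdet
      -- The invariants agree here, but the delta form takes the value `τ i = ±l i`, off the real
      -- line through `l`.
      have hf := form_real_of_diag
        (by rw [neg_mul, Complex.neg_im, mul_conj_im_self, neg_zero]) h 0 1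
      rw [show form (Canon.delta τ hτ).mat 0 1 = τ * Complex.I by simp [form, Canon.mat],
        mul_right_comm] at hf
      rcases mul_self_eq_mul_self_iff.1 h2 with h3 | h3 <;> subst h3
      · rw [mul_conj_self hl] at hf
        norm_num at hf
      · rw [neg_mul, mul_conj_self hl] at hf
        norm_num at hf
    | _ => simp only [Canon.detNorm, Canon.crossRe] at hd hc; exfalso; nlinarith
  | same l hl =>
    cases b with
    | generic μ ν hμ hν h1 h2 =>
      have hb := Canon.abs_crossRe_generic hμ hν h1 h2
      simp only [Canon.detNorm, Canon.crossRe] at hd hc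
      nlinarith
    | anti σ hσ =>
      simp only [Canon.detNorm, Canon.crossRe] at hd hc
      nlinarith [norm_nonneg σ, mul_nonneg hr (sq_nonneg ‖σ‖)]
    | same m hm =>
      obtain rfl : l = m := eq_of_form_diag hl hm (mul_conj_im_self m)
        (by rw [mul_conj_self hm]; simp) rfl h
      exact .refl
    | _ => simp only [Canon.detNorm, Canon.crossRe] at hd hc; exfalso; nlinarith
  | opp l hl =>
    cases b with
    | generic μ ν hμ hν h1 h2 =>
      have hb := Canon.abs_crossRe_generic hμ hν h1 h2
      simp only [Canon.detNorm, Canon.crossRe] at hd hc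
      nlinarith
    | anti σ hσ =>
      simp only [Canon.detNorm, Canon.crossRe] at hd hc
      have : 0 < r := by rcases hr.lt_or_eq with h | h <;> [exact h; (subst h; linarith)]
      nlinarith [norm_nonneg σ, mul_pos this (pow_pos (sub_pos.2 hσ) 2)]
    | opp m hm =>
      simp only [Canon.detNorm, Canon.crossRe, mul_one] at hd hc
      subst hd
      have h2 : l * l = m * m := by simpa [Canon.mat, Matrix.det_fin_two] using hdet
      rcases mul_self_eq_mul_self_iff.1 h2 with h3 | h3 <;> subst h3
      · exact .refl
      · exact refl_of_eq (vertex_opp_neg hm hl).symm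
    | delta τ hτ =>
      simp only [Canon.detNorm, Canon.crossRe, mul_one] at hd hc
      subst hd
      have h2 : τ * τ = l * l := by simpa [Canon.mat, Matrix.det_fin_two] using hdet.symm
      exact .single (adj_of_arrow (.opp_delta l τ hl hτ (mul_self_eq_mul_self_iff.1 h2)))
    | _ => simp only [Canon.detNorm, Canon.crossRe] at hd hc; exfalso; nlinarith

/-! ### The closure order and the closure graph -/

theorem path_iff_subset (v w : Vertex) :
    Relation.ReflTransGen graphTwo.Adj v w ↔ vertexClass v ⊆ closure (vertexClass w) := by
  refine ⟨vertexClass_subset_of_path, fun h => ?_⟩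
  obtain ⟨a, rfl⟩ := exists_vertex_eq v
  obtain ⟨b, rfl⟩ := exists_vertex_eq w
  exact path_of_mem_closure ((vertexClass_subset_closure_iff a b).1 h)

theorem level_eq_of_perm {a b : Canon} (h : Canon.Perm a b) : a.level = b.level := by
  cases h <;> rfl

/-- The codimension of a vertex. -/
def vertexLevel : Vertex → ℕ :=
  Quotient.lift Canon.level fun _ _ => level_eq_of_perm

theorem level_lt_of_arrow {a b : Canon} (h : Canon.Arrow a b) : b.level < a.level := by
  cases h <;> simp [Canon.level]

theorem level_lt_of_adj {v w : Vertex} (h : graphTwo.Adj v w) : vertexLevel w < vertexLevel v := by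
  obtain ⟨a, b, rfl, rfl, h⟩ := h
  exact level_lt_of_arrow h

theorem level_le_of_path {v w : Vertex} (h : Relation.ReflTransGen graphTwo.Adj v w) :
    vertexLevel w ≤ vertexLevel v := by
  induction h with
  | refl => exact le_rfl
  | tail _ h ih => exact (level_lt_of_adj h).le.trans ih

theorem eq_or_level_lt_of_path {v w : Vertex} (h : Relation.ReflTransGen graphTwo.Adj v w) :
    v = w ∨ vertexLevel w < vertexLevel v := by
  rcases h.cases_head with h | ⟨u, h1, h2⟩
  · exact .inl h
  · exact .inr ((level_le_of_path h2).trans_lt (level_lt_of_adj h1))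

theorem path_antisymm {v w : Vertex} (h : Relation.ReflTransGen graphTwo.Adj v w)
    (h' : Relation.ReflTransGen graphTwo.Adj w v) : v = w := by
  rcases eq_or_level_lt_of_path h with h1 | h1
  · exact h1
  · exact absurd (level_le_of_path h') (not_le.2 h1)

/-- Equal classes lie in each other's closures, so there are paths both ways, and these force
equality because the codimension drops along every arrow. -/
theorem vertexClass_injective : Function.Injective vertexClass := fun v w h =>
  path_antisymm ((path_iff_subset v w).2 (h ▸ subset_closure))
    ((path_iff_subset w v).2 (h ▸ subset_closure))

theorem starClass_mem_classes {n : ℕ} (A : Matrix (Fin n) (Fin n) ℂ) :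
    starClass A ∈ (starSetoid n).classes :=
  ⟨A, Set.ext fun _ => ⟨StarCongruent.symm, StarCongruent.symm⟩⟩

theorem vertexClass_mem_classes (v : Vertex) : vertexClass v ∈ (starSetoid 2).classes := by
  obtain ⟨a, rfl⟩ := exists_vertex_eq v
  rw [vertexClass_vertex]
  exact starClass_mem_classes _

theorem exists_vertexClass_eq {M : Set (Matrix (Fin 2) (Fin 2) ℂ)}
    (hM : M ∈ (starSetoid 2).classes) : ∃ v, vertexClass v = M := by
  obtain ⟨A, rfl⟩ := hM
  obtain ⟨a, ha⟩ := exists_canon A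
  refine ⟨a.vertex, ?_⟩
  rw [vertexClass_vertex, ← starClass_eq ha]
  exact Set.ext fun _ => ⟨StarCongruent.symm, StarCongruent.symm⟩

theorem mem_closure_vertexClass_iff {v w : Vertex} {A : Matrix (Fin 2) (Fin 2) ℂ}
    (hA : A ∈ vertexClass v) :
    A ∈ closure (vertexClass w) ↔ Relation.ReflTransGen graphTwo.Adj v w := by
  rw [path_iff_subset]
  refine ⟨fun h => ?_, fun h => h hA⟩
  obtain ⟨a, rfl⟩ := exists_vertex_eq v
  obtain ⟨b, rfl⟩ := exists_vertex_eq w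
  rw [vertexClass_vertex] at hA
  rw [vertexClass_subset_closure_iff]
  rw [vertexClass_vertex] at h
  exact mem_closure_starClass_of_starCongruent (StarCongruent.symm hA) h

theorem vertexClass_nonempty (v : Vertex) : (vertexClass v).Nonempty := by
  obtain ⟨a, rfl⟩ := exists_vertex_eq v
  rw [vertexClass_vertex]
  exact ⟨_, mem_starClass_self _⟩

theorem isClosureGraph_graphTwo : IsClosureGraph 2 graphTwo vertexClass where
  bijOn := ⟨fun v _ => vertexClass_mem_classes v, vertexClass_injective.injOn,
    fun M hM => (exists_vertexClass_eq hM).imp fun _ h => ⟨Set.mem_univ _, h⟩⟩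
  path_iff_one v w := by
    constructor
    · intro h
      obtain ⟨A, hA⟩ := vertexClass_nonempty v
      exact ⟨A, hA, (mem_closure_vertexClass_iff hA).2 h⟩
    · rintro ⟨A, hA, h⟩
      exact (mem_closure_vertexClass_iff hA).1 h
  path_iff_each v w := by
    constructor
    · exact fun h A hA => (mem_closure_vertexClass_iff hA).2 h
    · intro h
      obtain ⟨A, hA⟩ := vertexClass_nonempty v
      exact (mem_closure_vertexClass_iff hA).1 (h A hA)

/-! ### Covering pairs -/

theorem closureCovers_iff_path (v w : Vertex) :
    ClosureCovers (vertexClass v) (vertexClass w) ↔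
      Relation.ReflTransGen graphTwo.Adj v w ∧ v ≠ w ∧ ∀ u,
        Relation.ReflTransGen graphTwo.Adj v u → Relation.ReflTransGen graphTwo.Adj u w →
          u = v ∨ u = w := by
  simp only [path_iff_subset]
  constructor
  · rintro ⟨h1, h2, h3⟩
    refine ⟨h1, fun h => h2 (h ▸ rfl), fun u hu hu' => ?_⟩
    exact (h3 _ (vertexClass_mem_classes u) hu hu').imp (@vertexClass_injective _ _)
      (@vertexClass_injective _ _)
  · rintro ⟨h1, h2, h3⟩
    refine ⟨h1, fun h => h2 (vertexClass_injective h), fun M hM hu hu' => ?_⟩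
    obtain ⟨u, rfl⟩ := exists_vertexClass_eq hM
    exact (h3 u hu hu').imp (congrArg _) (congrArg _)

theorem arrow_of_hasseArrow {a b : Canon} (h : Canon.HasseArrow a b) : Canon.Arrow a b := by
  cases h with
  | zero_rankOne l hl => exact .zero_rankOne l hl
  | rankOne_same l hl => exact .rankOne_same l hl
  | rankOne_opp l hl => exact .rankOne_opp l hl
  | rankOne_generic l μ ν hl hμ hν h1 h2 h => exact .rankOne_generic l μ ν hl hμ hν h1 h2 h
  | rankOne_anti l σ hl hσ => exact .rankOne_anti l σ hl hσ
  | rankOne_delta l τ hl hτ h => exact .rankOne_delta l τ hl hτ h.le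
  | opp_delta l τ hl hτ h => exact .opp_delta l τ hl hτ h

theorem path_iff_mem_closure (a b : Canon) :
    Relation.ReflTransGen graphTwo.Adj a.vertex b.vertex ↔ a.mat ∈ closure (starClass b.mat) := by
  rw [path_iff_subset, vertexClass_subset_closure_iff]

theorem eq_or_eq_neg_of_opp_mem_closure_delta {l τ : ℂ} {hl : ‖l‖ = 1} {hτ : ‖τ‖ = 1}
    (h : (Canon.opp l hl).mat ∈ closure (starClass (Canon.delta τ hτ).mat)) : τ = l ∨ τ = -l := by
  obtain ⟨r, -, hd, hc, hdet⟩ := Canon.exists_ray h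
  simp only [Canon.detNorm, mul_one] at hd
  subst hd
  exact mul_self_eq_mul_self_iff.1 (by simpa [Canon.mat, Matrix.det_fin_two] using hdet.symm)

theorem im_eq_zero_of_eq_or_eq_neg {l τ : ℂ} (h : l = τ ∨ l = -τ) : (l * conj τ).im = 0 := by
  rcases h with rfl | rfl
  · exact mul_conj_im_self _
  · rw [neg_mul, Complex.neg_im, mul_conj_im_self, neg_zero]

/-- A proper intermediate vertex has a codimension strictly in between, which leaves only `diag(m,
±m)` between codimensions 5 and 2. The invariant ray excludes these, except `diag(m, -m)` below a
delta matrix; that would give `l = ±τ`, against the strict inequality. -/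
theorem eq_or_eq_of_hasseArrow {a b c : Canon} (h : Canon.HasseArrow a b)
    (hac : Relation.ReflTransGen graphTwo.Adj a.vertex c.vertex)
    (hcb : Relation.ReflTransGen graphTwo.Adj c.vertex b.vertex) :
    c.vertex = a.vertex ∨ c.vertex = b.vertex := by
  by_contra! hne
  have h1 : c.level < a.level := (eq_or_level_lt_of_path hac).resolve_left hne.1.symm
  have h2 : b.level < c.level := (eq_or_level_lt_of_path hcb).resolve_left hne.2
  rw [path_iff_mem_closure] at hac hcb
  obtain ⟨r, hr, hd, hc, -⟩ := Canon.exists_ray hcb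
  cases h with
  | zero_rankOne => cases c <;> simp [Canon.level] at h1 h2
  | rankOne_same => cases c <;> simp [Canon.level] at h1 h2
  | rankOne_opp => cases c <;> simp [Canon.level] at h1 h2
  | opp_delta => cases c <;> simp [Canon.level] at h1 h2
  | rankOne_generic l μ ν hl hμ hν e1 e2 h =>
    have hb := Canon.abs_crossRe_generic hμ hν e1 e2
    cases c <;> simp [Canon.level] at h1 h2 <;>
      · simp only [Canon.detNorm, Canon.crossRe] at hd hc
        nlinarith
  | rankOne_anti l σ hl hσ =>
    cases c <;> simp [Canon.level] at h1 h2 <;>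
      · simp only [Canon.detNorm, Canon.crossRe] at hd hc
        have : 0 < r := by rcases hr.lt_or_eq with h | h <;> [exact h; (subst h; linarith)]
        nlinarith [norm_nonneg σ, mul_pos this (pow_pos (sub_pos.2 hσ) 2)]
  | rankOne_delta l τ hl hτ h =>
    cases c <;> simp [Canon.level] at h1 h2
    · simp only [Canon.detNorm, Canon.crossRe] at hd hc
      linarith
    · rename_i m hm
      have e1 := eq_or_eq_neg_of_rankOne_mem_closure_opp hl hm hac
      have e2 := eq_or_eq_neg_of_opp_mem_closure_delta hcb
      have : l = τ ∨ l = -τ := by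
        rcases e1 with rfl | rfl <;> rcases e2 with rfl | rfl <;> simp
      rw [im_eq_zero_of_eq_or_eq_neg this] at h
      exact lt_irrefl _ h

theorem closureCovers_iff (v w : Vertex) :
    ClosureCovers (vertexClass v) (vertexClass w) ↔
      ∃ a b : Canon, a.vertex = v ∧ b.vertex = w ∧ Canon.HasseArrow a b := by
  rw [closureCovers_iff_path]
  constructor
  · rintro ⟨h1, h2, h3⟩
    have hadj : graphTwo.Adj v w := by
      rcases h1.cases_head with h | ⟨u, hvu, huw⟩
      · exact absurd h h2
      · rcases h3 u (.single hvu) huw with rfl | rfl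
        · exact absurd (level_lt_of_adj hvu) (lt_irrefl _)
        · exact hvu
    obtain ⟨a, b, rfl, rfl, h⟩ := hadj
    -- An arrow that factors through a vertex of intermediate codimension is not a cover.
    have mid : ∀ c : Canon, c.level < a.level → b.level < c.level → Canon.Arrow a c →
        Canon.Arrow c b → False := by
      intro c hc hc' hac hcb
      rcases h3 c.vertex (.single (adj_of_arrow hac)) (.single (adj_of_arrow hcb)) with e | e
      · exact hc.ne (congrArg vertexLevel e)
      · exact hc'.ne' (congrArg vertexLevel e)
    refine ⟨a, b, rfl, rfl, ?_⟩
    cases h with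
    | zero_rankOne l hl => exact .zero_rankOne l hl
    | zero_generic μ ν hμ hν e1 e2 =>
      exact (mid (.rankOne μ hμ) (by simp [Canon.level]) (by simp [Canon.level])
        (.zero_rankOne μ hμ) (.rankOne_generic μ μ ν hμ hμ hν e1 e2
          ⟨1, 0, zero_le_one, le_rfl, by simp⟩)).elim
    | zero_delta τ hτ =>
      exact (mid (.rankOne τ hτ) (by simp [Canon.level]) (by simp [Canon.level])
        (.zero_rankOne τ hτ) (.rankOne_delta τ τ hτ hτ (mul_conj_im_self τ).ge)).elim
    | rankOne_same l hl => exact .rankOne_same l hl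
    | rankOne_opp l hl => exact .rankOne_opp l hl
    | rankOne_generic l μ ν hl hμ hν e1 e2 h => exact .rankOne_generic l μ ν hl hμ hν e1 e2 h
    | rankOne_anti l σ hl hσ => exact .rankOne_anti l σ hl hσ
    | rankOne_delta l τ hl hτ h =>
      rcases h.lt_or_eq with h | h
      · exact .rankOne_delta l τ hl hτ h
      · refine (mid (.opp l hl) (by simp [Canon.level]) (by simp [Canon.level])
          (.rankOne_opp l hl) (.opp_delta l τ hl hτ ?_)).elim
        exact eq_or_eq_neg_of_im_eq_zero hτ hl (by rw [mul_conj_im_swap, ← h, neg_zero])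
    | opp_delta l τ hl hτ h => exact .opp_delta l τ hl hτ h
  · rintro ⟨a, b, rfl, rfl, h⟩
    have harr := arrow_of_hasseArrow h
    refine ⟨.single (adj_of_arrow harr), fun e => ?_, fun u hu hu' => ?_⟩
    · exact (level_lt_of_arrow harr).ne' (congrArg vertexLevel e)
    · obtain ⟨c, rfl⟩ := exists_vertex_eq u
      exact eq_or_eq_of_hasseArrow h hu hu'

/-- Adjacency always implies membership in the closure, so two implications close the cycle. -/
theorem arrowIff_of {a b : Canon} {p : Prop} (h : a.mat ∈ closure (starClass b.mat) → p)
    (h' : p → graphTwo.Adj a.vertex b.vertex) : ArrowIff a b p :=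
  have h0 : graphTwo.Adj a.vertex b.vertex → a.mat ∈ closure (starClass b.mat) :=
    fun h => (path_iff_mem_closure a b).1 (.single h)
  ⟨⟨fun hadj => h (h0 hadj), h'⟩, ⟨h, fun hp => h0 (h' hp)⟩⟩

/-! ### Decomposition into canonical blocks -/

theorem isCanonical_of_block {n : ℕ} {A : Matrix (Fin n) (Fin n) ℂ} (hA : IsCanonicalBlock A) :
    IsCanonical A := by
  have h := IsCanonical.cons A _ hA .empty
  suffices e : A = directSum A (0 : Matrix (Fin 0) (Fin 0) ℂ) from e ▸ h
  refine Matrix.ext fun i j => ?_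
  have hi : (finSumFinEquiv (m := n) (n := 0)).symm i = Sum.inl i :=
    finSumFinEquiv_symm_apply_castAdd (n := 0) i
  have hj : (finSumFinEquiv (m := n) (n := 0)).symm j = Sum.inl j :=
    finSumFinEquiv_symm_apply_castAdd (n := 0) j
  simp only [directSum, Matrix.reindex_apply, Matrix.submatrix_apply]
  erw [hi, hj]
  rfl

theorem isCanonical_diag {α β : ℂ} (hα : IsCanonicalBlock !![α]) (hβ : IsCanonicalBlock !![β]) :
    IsCanonical !![α, 0; 0, β] := by
  have h := IsCanonical.cons _ _ hα (isCanonical_of_block hβ)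
  convert h using 1
  ext i j
  fin_cases i <;> fin_cases j <;> rfl

theorem isCanonicalBlock_unit {l : ℂ} (hl : ‖l‖ = 1) : IsCanonicalBlock !![l] := by
  convert IsCanonicalBlock.delta 1 l one_pos hl using 1
  ext i j
  fin_cases i; fin_cases j
  simp [deltaBlock]

theorem isCanonicalBlock_zero : IsCanonicalBlock !![(0 : ℂ)] := by
  convert IsCanonicalBlock.nilpotent 1 one_pos using 1
  ext i j
  fin_cases i; fin_cases j
  simp [jordanBlock]

theorem isCanonical_mat (a : Canon) : IsCanonical a.mat := by
  cases a with
  | generic μ ν hμ hν =>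
    exact isCanonical_diag (isCanonicalBlock_unit hμ) (isCanonicalBlock_unit hν)
  | anti σ hσ =>
    apply isCanonical_of_block
    -- The value `σ = 0` is not allowed in a skew block; the matrix is then the nilpotent block
    -- `J_2(0)`.
    by_cases h : σ = 0
    · subst h
      convert IsCanonicalBlock.nilpotent 2 two_pos using 1
      ext i j
      fin_cases i <;> fin_cases j <;> simp [jordanBlock, Canon.mat]
    · convert IsCanonicalBlock.skew 1 σ one_pos h hσ using 1
      ext i j
      fin_cases i <;> fin_cases j <;> rfl
  | delta τ hτ =>
    apply isCanonical_of_block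
    convert IsCanonicalBlock.delta 2 τ two_pos hτ using 1
    ext i j
    fin_cases i <;> fin_cases j <;> simp [deltaBlock, Canon.mat]
  | same l hl => exact isCanonical_diag (isCanonicalBlock_unit hl) (isCanonicalBlock_unit hl)
  | opp l hl =>
    exact isCanonical_diag (isCanonicalBlock_unit hl) (isCanonicalBlock_unit (by rwa [norm_neg]))
  | rankOne l hl => exact isCanonical_diag (isCanonicalBlock_unit hl) isCanonicalBlock_zero
  | zero =>
    have := isCanonical_diag isCanonicalBlock_zero isCanonicalBlock_zero
    rwa [show !![(0 : ℂ), 0; 0, 0] = 0 from (Matrix.eta_fin_two 0).symm] at this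

/-! ### Infinitely many vertices in each family -/

/-- A sequence of distinct points in the open right half of the unit circle, other than `1`. -/
noncomputable def circlePoint (k : ℕ) : ℂ := ⟨1 / (k + 2), Real.sqrt (1 - (1 / (k + 2)) ^ 2)⟩

theorem one_div_add_two_mem (k : ℕ) : (0 : ℝ) < 1 / (k + 2) ∧ 1 / ((k : ℝ) + 2) < 1 := by
  have : (0 : ℝ) ≤ k := k.cast_nonneg
  constructor
  · positivity
  · rw [div_lt_one (by linarith)]
    linarith

theorem one_div_add_two_injective : Function.Injective fun k : ℕ => 1 / ((k : ℝ) + 2) := by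
  intro j k h
  have : (j : ℝ) = k := by simpa using h
  exact_mod_cast this

theorem norm_circlePoint (k : ℕ) : ‖circlePoint k‖ = 1 := by
  obtain ⟨h0, h1⟩ := one_div_add_two_mem k
  rw [← sq_eq_sq₀ (norm_nonneg _) zero_le_one, ← Complex.normSq_eq_norm_sq, Complex.normSq_apply]
  simp only [circlePoint]
  rw [Real.mul_self_sqrt (by nlinarith)]
  ring

theorem circlePoint_injective : Function.Injective circlePoint := fun _ _ h =>
  one_div_add_two_injective (congrArg Complex.re h)

/-- Both real parts are positive. Having no antipodal points keeps the vertices `diag(l, -l)`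
distinct despite the swap of `l` and `-l`. -/
theorem circlePoint_ne_neg (j k : ℕ) : circlePoint j ≠ -circlePoint k := by
  intro h
  have := congrArg Complex.re h
  simp only [circlePoint, Complex.neg_re] at this
  linarith [(one_div_add_two_mem j).1, (one_div_add_two_mem k).1]

theorem one_ne_circlePoint (k : ℕ) : 1 ≠ circlePoint k := by
  intro h
  have := congrArg Complex.re h
  simp only [circlePoint, Complex.one_re] at this
  linarith [(one_div_add_two_mem k).2]

theorem one_ne_neg_circlePoint (k : ℕ) : 1 ≠ -circlePoint k := by
  intro h
  have := congrArg Complex.re h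
  simp only [circlePoint, Complex.one_re, Complex.neg_re] at this
  linarith [(one_div_add_two_mem k).1]

theorem infinite_of_seq {S : Set Vertex} (f : ℕ → Canon) (hf : ∀ k, (f k).vertex ∈ S)
    (h : ∀ j k, Canon.Perm (f j) (f k) → j = k) : S.Infinite :=
  Set.infinite_of_injective_forall_mem (f := fun k => (f k).vertex)
    (fun j k hjk => h j k (Quotient.exact hjk)) hf

theorem infinite_generic :
    {v | ∃ μ ν hμ hν h1 h2, v = (Canon.generic μ ν hμ hν h1 h2).vertex}.Infinite := by
  refine infinite_of_seq (fun k => .generic 1 (circlePoint k) norm_one (norm_circlePoint k)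
    (one_ne_circlePoint k) (one_ne_neg_circlePoint k)) (fun k => ⟨_, _, _, _, _, _, rfl⟩) ?_
  intro j k h
  -- `cases` on `Perm` needs variables as indices; the equations keep the parameters.
  generalize ha : Canon.generic 1 (circlePoint j) _ _ _ _ = a at h
  generalize hb : Canon.generic 1 (circlePoint k) _ _ _ _ = b at h
  cases h with
  | refl =>
    rw [← ha] at hb
    injection hb with h1 h2
    exact (circlePoint_injective h2).symm
  | swapGeneric =>
    injection ha with h1 h2
    injection hb with h3 h4
    exact absurd (h1.trans h4.symm) (one_ne_circlePoint k)
  | swapOpp => cases ha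

theorem infinite_anti : {v | ∃ σ hσ, v = (Canon.anti σ hσ).vertex}.Infinite := by
  have hn : ∀ k : ℕ, ‖((1 / ((k : ℝ) + 2) : ℝ) : ℂ)‖ < 1 := fun k => by
    obtain ⟨h0, h1⟩ := one_div_add_two_mem k
    rw [Complex.norm_real, Real.norm_of_nonneg h0.le]
    exact h1
  refine infinite_of_seq (fun k => .anti _ (hn k)) (fun k => ⟨_, _, rfl⟩) ?_
  intro j k h
  generalize ha : Canon.anti _ (hn j) = a at h
  generalize hb : Canon.anti _ (hn k) = b at h
  cases h with
  | refl =>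
    rw [← ha] at hb
    injection hb with h1
    exact (one_div_add_two_injective (Complex.ofReal_injective h1)).symm
  | _ => cases ha

theorem infinite_delta : {v | ∃ τ hτ, v = (Canon.delta τ hτ).vertex}.Infinite := by
  refine infinite_of_seq (fun k => .delta _ (norm_circlePoint k)) (fun k => ⟨_, _, rfl⟩) ?_
  intro j k h
  generalize ha : Canon.delta _ (norm_circlePoint j) = a at h
  generalize hb : Canon.delta _ (norm_circlePoint k) = b at h
  cases h with
  | refl =>
    rw [← ha] at hb
    injection hb with h1
    exact (circlePoint_injective h1).symm
  | _ => cases ha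

theorem infinite_same : {v | ∃ l hl, v = (Canon.same l hl).vertex}.Infinite := by
  refine infinite_of_seq (fun k => .same _ (norm_circlePoint k)) (fun k => ⟨_, _, rfl⟩) ?_
  intro j k h
  generalize ha : Canon.same _ (norm_circlePoint j) = a at h
  generalize hb : Canon.same _ (norm_circlePoint k) = b at h
  cases h with
  | refl =>
    rw [← ha] at hb
    injection hb with h1
    exact (circlePoint_injective h1).symm
  | _ => cases ha

theorem infinite_opp : {v | ∃ l hl, v = (Canon.opp l hl).vertex}.Infinite := by
  refine infinite_of_seq (fun k => .opp _ (norm_circlePoint k)) (fun k => ⟨_, _, rfl⟩) ?_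
  intro j k h
  generalize ha : Canon.opp _ (norm_circlePoint j) = a at h
  generalize hb : Canon.opp _ (norm_circlePoint k) = b at h
  cases h with
  | refl =>
    rw [← ha] at hb
    injection hb with h1
    exact (circlePoint_injective h1).symm
  | swapGeneric => cases ha
  | swapOpp =>
    injection ha with h1
    injection hb with h2
    exact absurd (h2.trans (congrArg _ h1.symm)) (circlePoint_ne_neg k j)

theorem infinite_rankOne : {v | ∃ l hl, v = (Canon.rankOne l hl).vertex}.Infinite := by
  refine infinite_of_seq (fun k => .rankOne _ (norm_circlePoint k)) (fun k => ⟨_, _, rfl⟩) ?_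
  intro j k h
  generalize ha : Canon.rankOne _ (norm_circlePoint j) = a at h
  generalize hb : Canon.rankOne _ (norm_circlePoint k) = b at h
  cases h with
  | refl =>
    rw [← ha] at hb
    injection hb with h1
    exact (circlePoint_injective h1).symm
  | _ => cases ha

end StarCong

theorem theorem1 :
    -- the graph is a closure graph for *congruence classes of 2 × 2 matrices
    StarCong.IsClosureGraph 2 StarCong.graphTwo StarCong.vertexClass ∧
    -- its vertices are given by direct sums of canonical blocks
    (∀ a : StarCong.Canon, StarCong.IsCanonical a.mat) ∧
    -- each family of vertices, except for the zero matrix, is infinite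
    {v | ∃ μ ν hμ hν h1 h2, v = (StarCong.Canon.generic μ ν hμ hν h1 h2).vertex}.Infinite ∧
    {v | ∃ σ hσ, v = (StarCong.Canon.anti σ hσ).vertex}.Infinite ∧
    {v | ∃ τ hτ, v = (StarCong.Canon.delta τ hτ).vertex}.Infinite ∧
    {v | ∃ l hl, v = (StarCong.Canon.same l hl).vertex}.Infinite ∧
    {v | ∃ l hl, v = (StarCong.Canon.opp l hl).vertex}.Infinite ∧
    {v | ∃ l hl, v = (StarCong.Canon.rankOne l hl).vertex}.Infinite ∧
    -- the codimensions of the classes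
    (∀ a : StarCong.Canon, ∀ A ∈ StarCong.starClass a.mat, StarCong.realCodim A = a.level) ∧
    -- the exact conditions for the arrows
    (∀ l μ ν hl hμ hν h1 h2,
      StarCong.ArrowIff (.rankOne l hl) (.generic μ ν hμ hν h1 h2)
        (∃ a b : ℝ, 0 ≤ a ∧ 0 ≤ b ∧ l = μ * a + ν * b)) ∧
    (∀ l τ hl hτ, StarCong.ArrowIff (.rankOne l hl) (.delta τ hτ)
      (0 ≤ (l * (starRingEnd ℂ) τ).im)) ∧
    (∀ l τ hl hτ, StarCong.ArrowIff (.opp l hl) (.delta τ hτ) (τ = l ∨ τ = -l)) ∧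
    (∀ l m hl hm, StarCong.ArrowIff (.rankOne l hl) (.same m hm) (l = m)) ∧
    (∀ l m hl hm, StarCong.ArrowIff (.rankOne l hl) (.opp m hm) (l = m ∨ l = -m)) ∧
    (∀ l σ hl hσ, StarCong.ArrowIff (.rankOne l hl) (.anti σ hσ) True) ∧
    (∀ l hl, StarCong.ArrowIff .zero (.rankOne l hl) True) ∧
    (∀ μ ν hμ hν h1 h2, StarCong.ArrowIff .zero (.generic μ ν hμ hν h1 h2) True) ∧
    (∀ τ hτ, StarCong.ArrowIff .zero (.delta τ hτ) True) ∧
    -- the closure relation is antisymmetric, and the covering pairs are as listed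
    (∀ v w, StarCong.vertexClass v ⊆ closure (StarCong.vertexClass w) →
      StarCong.vertexClass w ⊆ closure (StarCong.vertexClass v) → v = w) ∧
    (∀ v w, StarCong.ClosureCovers (StarCong.vertexClass v) (StarCong.vertexClass w) ↔
      ∃ a b : StarCong.Canon, a.vertex = v ∧ b.vertex = w ∧ StarCong.Canon.HasseArrow a b) := by
  refine ⟨StarCong.isClosureGraph_graphTwo, StarCong.isCanonical_mat, StarCong.infinite_generic,
    StarCong.infinite_anti, StarCong.infinite_delta, StarCong.infinite_same,
    StarCong.infinite_opp, StarCong.infinite_rankOne,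
    fun a A hA => StarCong.realCodim_eq_level a hA, ?_, ?_, ?_, ?_, ?_, ?_, ?_, ?_, ?_, ?_,
    StarCong.closureCovers_iff⟩
  · exact fun l μ ν hl hμ hν h1 h2 => StarCong.arrowIff_of
      (StarCong.cone_of_rankOne_mem_closure hμ hν h1 h2)
      fun h => StarCong.adj_of_arrow (.rankOne_generic l μ ν hl hμ hν h1 h2 h)
  · exact fun l τ hl hτ => StarCong.arrowIff_of (StarCong.im_nonneg_of_rankOne_mem_closure hτ)
      fun h => StarCong.adj_of_arrow (.rankOne_delta l τ hl hτ h)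
  · exact fun l τ hl hτ => StarCong.arrowIff_of StarCong.eq_or_eq_neg_of_opp_mem_closure_delta
      fun h => StarCong.adj_of_arrow (.opp_delta l τ hl hτ h)
  · refine fun l m hl hm => StarCong.arrowIff_of
      (StarCong.eq_of_rankOne_mem_closure_same hl hm) ?_
    rintro rfl
    exact StarCong.adj_of_arrow (.rankOne_same l hl)
  · exact fun l m hl hm => StarCong.arrowIff_of
      (StarCong.eq_or_eq_neg_of_rankOne_mem_closure_opp hl hm) (StarCong.adj_rankOne_opp hl hm)
  · exact fun l σ hl hσ => StarCong.arrowIff_of (fun _ => trivial)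
      fun _ => StarCong.adj_of_arrow (.rankOne_anti l σ hl hσ)
  · exact fun l hl => StarCong.arrowIff_of (fun _ => trivial)
      fun _ => StarCong.adj_of_arrow (.zero_rankOne l hl)
  · exact fun μ ν hμ hν h1 h2 => StarCong.arrowIff_of (fun _ => trivial)
      fun _ => StarCong.adj_of_arrow (.zero_generic μ ν hμ hν h1 h2)
  · exact fun τ hτ => StarCong.arrowIff_of (fun _ => trivial)
      fun _ => StarCong.adj_of_arrow (.zero_delta τ hτ)
  · exact fun v w h h' => StarCong.path_antisymm ((StarCong.path_iff_subset v w).2 h)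
      ((StarCong.path_iff_subset w v).2 h')
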